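/- Let $V$ be a finite-dimensional complex vector space and $W\subseteq \mathrm{GL}(V)$ a finite complex reflection group. Its reflection arrangement $\mathcal A=\mathcal A(W)$ is the set of hyperplanes of $V$ that are the fixed space of some element of $W$. Let $L(\mathcal A)$ be the set of all intersections of members of $\mathcal A$ (including $V$ as the empty intersection), ordered by reverse inclusion, with rank $r(X)=\operatorname{codim}_V X$. An element $X\in L(\mathcal A)$ is called modular if $X+Y\in L(\mathcal A)$ for every $Y\in L(\mathcal A)$. The arrangement $\mathcal A$ is called supersolvable if there is a maximal chain $V=X_0<X_1<\dots<X_r=\bigcap_{H\in\mathcal A}H$ in $L(\mathcal A)$, where $r$ is the rank of $\mathcal A$, all of whose members $X_i$ are modular. Suppose that, up to a linear change of coordinates, $W$ is one of the following groups: (a) the Coxeter group of type $D_\ell$ with $\ell\ge 5$, $E_6$, $E_7$, $E_8$ or $H_4$, acting by its complexified geometric representation, i.e. the group generated by the reflections $v\mapsto v-2B(e_i,v)e_i$ of the complex space with basis $(e_i)$, where $B(e_i,e_j)=-\cos(\pi/m_{ij})$ and $(m_{ij})$ is the Coxeter matrix; (b) the Shephard–Todd group $G_{32}\subseteq\mathrm{GL}_4(\mathbb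 C)$ of order $155520$, generated by the four reflections of order $3$, $v\mapsto v-(1-\omega)\frac{\langle a,v\rangle}{\langle a,a\rangle}a$ with $\omega=e^{2\pi i/3}$ and $a=(1,0,0,0),\ (1,1,1,0),\ (0,1,0,0),\ (0,1,-1,1)$. Then $L(\mathcal A(W))$ has no modular element of rank $2$. In particular, $\mathcal A(W)$ is not supersolvable. -/

import Mathlib

noncomputable section

namespace ReflectionArrangement

section Arrangements

variable {V : Type*} [AddCommGroup V] [Module ℂ V]

/-- The intersection lattice `L(𝒜)`: all intersections of finitely many members of `𝒜`
(the empty intersection is `V`). It is ordered by reverse inclusion. -/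
def intersectionLattice (𝒜 : Set (Submodule ℂ V)) : Set (Submodule ℂ V) :=
  {X | ∃ S : Set (Submodule ℂ V), S ⊆ 𝒜 ∧ S.Finite ∧ X = sInf S}

/-- The rank of a subspace `X`, its codimension in `V`. -/
def rank (X : Submodule ℂ V) : ℕ := Module.finrank ℂ (V ⧸ X)

/-- `X` is a modular element of `L(𝒜)`: it lies in `L(𝒜)`, and so does `X + Y` for every
`Y ∈ L(𝒜)`. -/
def IsModular (𝒜 : Set (Submodule ℂ V)) (X : Submodule ℂ V) : Prop :=
  X ∈ intersectionLattice 𝒜 ∧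
    ∀ Y ∈ intersectionLattice 𝒜, X ⊔ Y ∈ intersectionLattice 𝒜

/-- `𝒜` is supersolvable: there is a chain `V = X₀ < X₁ < ⋯ < X_r` (for reverse inclusion) of
modular elements of `L(𝒜)` that ends in the intersection of all members of `𝒜`, where `r` is
the rank of `𝒜`. Since `r` is the largest possible length, such a chain is a maximal one; for an
essential arrangement `r = dim V` and `X_r = 0`. -/
def IsSupersolvable (𝒜 : Set (Submodule ℂ V)) : Prop :=
  ∃ X : ℕ → Submodule ℂ V, X 0 = ⊤ ∧ X (rank (sInf 𝒜)) = sInf 𝒜 ∧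
    (∀ i < rank (sInf 𝒜), X (i + 1) < X i) ∧ ∀ i ≤ rank (sInf 𝒜), IsModular 𝒜 (X i)

/-- The reflection arrangement `𝒜(W)` of a group `W` of linear automorphisms of `V`: the
hyperplanes that are the fixed space of some element of `W`. -/
def reflectionArrangement (W : Subgroup (V ≃ₗ[ℂ] V)) : Set (Submodule ℂ V) :=
  {H | rank H = 1 ∧ ∃ w ∈ W, LinearMap.fixedSubmodule (w : V →ₗ[ℂ] V) = H}

/-- Two linear groups, possibly on different spaces, are equal up to a linear change of
coordinates. -/
def IsLinearlyConjugate {V' : Type*} [AddCommGroup V'] [Module ℂ V']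
    (W : Subgroup (V ≃ₗ[ℂ] V)) (W' : Subgroup (V' ≃ₗ[ℂ] V')) : Prop :=
  ∃ φ : V ≃ₗ[ℂ] V', ∀ w : V ≃ₗ[ℂ] V, w ∈ W ↔ (φ.symm.trans w).trans φ ∈ W'

end Arrangements

section Coxeter

variable {B : Type*} [Fintype B] [DecidableEq B]

/-- The linear form `v ↦ 2 B(eᵢ, v)` on `ℂ^B`, where `B` is the canonical bilinear form of the
Coxeter matrix, `B(eᵢ, eⱼ) = - cos (π / mᵢⱼ)`. -/
def simpleCoroot (M : CoxeterMatrix B) (i : B) : Module.Dual ℂ (B → ℂ) :=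
  ∑ j, ((-2 * Real.cos (Real.pi / M i j) : ℝ) : ℂ) • LinearMap.proj j

theorem simpleCoroot_single (M : CoxeterMatrix B) (i : B) :
    simpleCoroot M i (Pi.single i 1) = 2 := by
  simp [simpleCoroot, Pi.single_apply]

/-- The simple reflection `v ↦ v - 2 B(eᵢ, v) eᵢ`. -/
def simpleReflection (M : CoxeterMatrix B) (i : B) : (B → ℂ) ≃ₗ[ℂ] (B → ℂ) :=
  Module.reflection (simpleCoroot_single M i)

/-- The image of the (complexified) geometric representation of the Coxeter group of `M`. -/
def coxeterReflectionGroup (M : CoxeterMatrix B) : Subgroup ((B → ℂ) ≃ₗ[ℂ] (B → ℂ)) :=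
  Subgroup.closure (Set.range (simpleReflection M))

/-- The Coxeter matrix of type `D_ℓ` in the numbering of Bourbaki, shifted to start at `0`: the
edges are `{i, i + 1}` for `i + 1 ≤ ℓ - 2`, and `{ℓ - 3, ℓ - 1}`. -/
def coxeterMatrixD (l : ℕ) : CoxeterMatrix (Fin l) where
  M := Matrix.of fun i j : Fin l ↦
    if i = j then 1
    else if ((i : ℕ) + 1 = j ∧ (j : ℕ) + 1 < l) ∨ ((j : ℕ) + 1 = i ∧ (i : ℕ) + 1 < l) ∨
        ((i : ℕ) + 3 = l ∧ (j : ℕ) + 1 = l) ∨ ((j : ℕ) + 3 = l ∧ (i : ℕ) + 1 = l) then 3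
    else 2
  isSymm := by
    ext i j
    simp only [Matrix.transpose_apply, Matrix.of_apply]
    split_ifs <;> first | rfl | (exfalso; grind)
  diagonal := by simp
  off_diagonal := by
    intro i j h
    simp only [Matrix.of_apply, if_neg h]
    split_ifs <;> decide

/-- `W` is a reflection group of the type given by the Coxeter matrix `M`. -/
def HasCoxeterType {V : Type*} [AddCommGroup V] [Module ℂ V]
    (M : CoxeterMatrix B) (W : Subgroup (V ≃ₗ[ℂ] V)) : Prop :=
  IsLinearlyConjugate W (coxeterReflectionGroup M)

end Coxeter

section G32

/-- The linear form `v ↦ (1 - ζ) ⟨a, v⟩ / ⟨a, a⟩` on `ℂⁿ`, for the standard Hermitian product. -/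
def rootForm {n : ℕ} (ζ : ℂ) (a : Fin n → ℂ) : Module.Dual ℂ (Fin n → ℂ) :=
  ((1 - ζ) / (star a ⬝ᵥ a)) • ∑ j, star (a j) • LinearMap.proj j

theorem rootForm_self {n : ℕ} (ζ : ℂ) (a : Fin n → ℂ) (ha : a ≠ 0) :
    rootForm ζ a a = 1 - ζ := by
  have h : star a ⬝ᵥ a ≠ 0 := by
    open scoped ComplexOrder in
    exact fun h => ha (dotProduct_star_self_eq_zero.mp h)
  have h2 : ∑ j, star (a j) * a j = star a ⬝ᵥ a := rfl
  simp only [rootForm, LinearMap.smul_apply, LinearMap.sum_apply, LinearMap.proj_apply,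
    smul_eq_mul, h2]
  field_simp

/-- The unitary reflection `v ↦ v - (1 - ζ) (⟨a, v⟩ / ⟨a, a⟩) a`, which fixes the hyperplane
orthogonal to `a` pointwise and multiplies `a` by `ζ`. -/
def unitaryReflection {n : ℕ} (ζ : ℂ) (hζ : ζ ≠ 0) (a : Fin n → ℂ) (ha : a ≠ 0) :
    (Fin n → ℂ) ≃ₗ[ℂ] (Fin n → ℂ) :=
  LinearEquiv.ofLinearMap (LinearMap.id - (rootForm ζ a).smulRight a)
    (LinearMap.id + (ζ⁻¹ • rootForm ζ a).smulRight a)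
    (by
      ext1 j
      ext1
      ext1 k
      simp [rootForm_self ζ a ha]
      field_simp
      ring)
    (by
      ext1 j
      ext1
      ext1 k
      simp [rootForm_self ζ a ha]
      field_simp
      ring)

/-- The roots of four generating reflections of `G₃₂`. -/
def g32Root : Fin 4 → Fin 4 → ℂ :=
  ![![1, 0, 0, 0], ![1, 1, 1, 0], ![0, 1, 0, 0], ![0, 1, -1, 1]]

theorem g32Root_ne_zero (i : Fin 4) : g32Root i ≠ 0 := by
  fin_cases i
  · exact fun h => by simpa [g32Root] using congrFun h 0
  · exact fun h => by simpa [g32Root] using congrFun h 0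
  · exact fun h => by simpa [g32Root] using congrFun h 1
  · exact fun h => by simpa [g32Root] using congrFun h 1

/-- The four generating reflections `s₀, s₁, s₂, s₃` of `G₃₂`. They have order `3`, satisfy
`sᵢ sᵢ₊₁ sᵢ = sᵢ₊₁ sᵢ sᵢ₊₁`, and commute otherwise. -/
def g32Reflection (i : Fin 4) : (Fin 4 → ℂ) ≃ₗ[ℂ] (Fin 4 → ℂ) :=
  unitaryReflection (Complex.exp (2 * Real.pi * Complex.I / 3)) (Complex.exp_ne_zero _)
    (g32Root i) (g32Root_ne_zero i)

/-- The Shephard-Todd group `G₃₂`, of order `155520`, in its reflection representation on `ℂ⁴`. -/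
def groupG32 : Subgroup ((Fin 4 → ℂ) ≃ₗ[ℂ] (Fin 4 → ℂ)) :=
  Subgroup.closure (Set.range g32Reflection)

end G32

end ReflectionArrangement

end

/-! A rank-two element of `L(𝒜)` is `X = x^⊥ ∩ y^⊥` for two roots `x`, `y`, and the hyperplanes
containing `X` are the `v^⊥` with `v` in the plane of `x` and `y`. To show that `X` is not modular
it suffices to find `Y ∈ L(𝒜)` such that exactly one line of this plane annihilates `Y`, and that
line contains no root: then `X + Y` is a proper subspace contained in no reflecting hyperplane
(`not_isModular`). Two things are therefore needed for each group: a description of all reflecting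
hyperplanes, and a suitable `Y` for each pair of roots.

Types D and E. The roots are the vectors of norm 2 in the root lattice. An element with a fixed
hyperplane is the orthogonal reflection in some primitive lattice vector `u`, because it is an
isometry; it moves each fundamental weight by a lattice vector, which forces `(u, u)` to divide 2
(`exists_root_of_mem_reflectionArrangement`). Up to sign, two distinct roots are orthogonal or have
product `-1`. If `x ⊥ y`, some root `z` has product 1 with both, and then `t = x + y - z` is a root.
With `Y = z^⊥ ∩ t^⊥` the critical line is spanned by `x + y = z + t`, of norm 4; a root on it would
have product `±√2` with `x`. If `(x, y) = -1`, the branch node provides roots `z`, `t` such that `x`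
is the center of a `D₄` with leaves `y`, `z`, `t` (`IsRoot.hasBranches`). With `u = 2x + y + z + t`
and `Y = u^⊥ ∩ z^⊥ ∩ t^⊥` the critical line is spanned by `2x + y`, of norm 6; a root on it would
have product `±√3` with `x`.

Types H₄ and G₃₂. The space has dimension four and the reflections are transitive on root lines, so
one may take `x` to be the first simple root. For `Y` one takes the line spanned by a root, which is
an intersection of three reflecting hyperplanes. That the listed hyperplanes are all of them, and
that each plane admits a suitable `Y`, are finite checks over `ℤ[φ]` and `ℤ[ω]`.

Supersolvability fails because in a strict chain of length equal to the rank of `𝒜`, the second step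
has rank exactly 2 (`not_isSupersolvable`). -/

noncomputable section

namespace ReflectionArrangement

open scoped ComplexConjugate

/-! ### Intersection lattices, modular elements and linear changes of coordinates. -/

section Lattice

variable {V V' : Type*} [AddCommGroup V] [Module ℂ V] [AddCommGroup V'] [Module ℂ V']

theorem rank_map (φ : V ≃ₗ[ℂ] V') (X : Submodule ℂ V) :
    rank (X.map (φ : V →ₗ[ℂ] V')) = rank X :=
  (Submodule.Quotient.equiv X _ φ rfl).finrank_eq.symm

theorem map_sInf (φ : V ≃ₗ[ℂ] V') (S : Set (Submodule ℂ V)) :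
    (sInf S).map (φ : V →ₗ[ℂ] V') = sInf (Submodule.map (φ : V →ₗ[ℂ] V') '' S) := by
  ext x
  simp only [Submodule.mem_sInf, Set.forall_mem_image, Submodule.mem_map_equiv]

theorem IsLinearlyConjugate.symm {W : Subgroup (V ≃ₗ[ℂ] V)} {W' : Subgroup (V' ≃ₗ[ℂ] V')}
    {φ : V ≃ₗ[ℂ] V'} (h : ∀ w : V ≃ₗ[ℂ] V, w ∈ W ↔ (φ.symm.trans w).trans φ ∈ W')
    (w : V' ≃ₗ[ℂ] V') : w ∈ W' ↔ (φ.symm.symm.trans w).trans φ.symm ∈ W := by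
  rw [h]
  convert Iff.rfl using 2
  ext x
  simp

theorem map_mem_reflectionArrangement {W : Subgroup (V ≃ₗ[ℂ] V)} {W' : Subgroup (V' ≃ₗ[ℂ] V')}
    {φ : V ≃ₗ[ℂ] V'} (h : ∀ w : V ≃ₗ[ℂ] V, w ∈ W ↔ (φ.symm.trans w).trans φ ∈ W')
    {H : Submodule ℂ V} (hH : H ∈ reflectionArrangement W) :
    H.map (φ : V →ₗ[ℂ] V') ∈ reflectionArrangement W' := by
  obtain ⟨hr, w, hw, rfl⟩ := hH
  refine ⟨by rw [rank_map, hr], _, (h w).1 hw, ?_⟩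
  ext x
  simp [Submodule.mem_map_equiv, LinearEquiv.eq_symm_apply]

theorem map_mem_intersectionLattice {𝒜 : Set (Submodule ℂ V)} {ℬ : Set (Submodule ℂ V')}
    {φ : V ≃ₗ[ℂ] V'} (h : ∀ H ∈ 𝒜, H.map (φ : V →ₗ[ℂ] V') ∈ ℬ)
    {X : Submodule ℂ V} (hX : X ∈ intersectionLattice 𝒜) :
    X.map (φ : V →ₗ[ℂ] V') ∈ intersectionLattice ℬ := by
  obtain ⟨S, hS, hf, rfl⟩ := hX
  exact ⟨_, Set.image_subset_iff.2 fun H hH => h H (hS hH), hf.image _, map_sInf φ S⟩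

theorem map_symm_map (φ : V ≃ₗ[ℂ] V') (X : Submodule ℂ V') :
    (X.map (φ.symm : V' →ₗ[ℂ] V)).map (φ : V →ₗ[ℂ] V') = X := by
  ext x
  simp [Submodule.mem_map_equiv]

theorem IsModular.map {W : Subgroup (V ≃ₗ[ℂ] V)} {W' : Subgroup (V' ≃ₗ[ℂ] V')}
    {φ : V ≃ₗ[ℂ] V'} (h : ∀ w : V ≃ₗ[ℂ] V, w ∈ W ↔ (φ.symm.trans w).trans φ ∈ W')
    {X : Submodule ℂ V} (hX : IsModular (reflectionArrangement W) X) :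
    IsModular (reflectionArrangement W') (X.map (φ : V →ₗ[ℂ] V')) := by
  have h₁ := fun H (hH : H ∈ reflectionArrangement W) => map_mem_reflectionArrangement h hH
  have h₂ := fun H (hH : H ∈ reflectionArrangement W') =>
    map_mem_reflectionArrangement (IsLinearlyConjugate.symm h) hH
  refine ⟨map_mem_intersectionLattice h₁ hX.1, fun Y hY => ?_⟩
  have := map_mem_intersectionLattice h₁ (hX.2 _ (map_mem_intersectionLattice h₂ hY))
  rwa [Submodule.map_sup, map_symm_map] at this

/-- This makes `g` a linear change of coordinates from `W` to itself, so that the transport lemmas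
show that `W` acts on its arrangement and preserves modularity. -/
theorem mem_conj_iff {W : Subgroup (V ≃ₗ[ℂ] V)} {g : V ≃ₗ[ℂ] V} (hg : g ∈ W) (w : V ≃ₗ[ℂ] V) :
    w ∈ W ↔ (g.symm.trans w).trans g ∈ W := by
  have : (g.symm.trans w).trans g = g * w * g⁻¹ := rfl
  rw [this, Subgroup.mul_mem_cancel_right _ (W.inv_mem hg), Subgroup.mul_mem_cancel_left _ hg]

theorem mem_intersectionLattice {𝒜 : Set (Submodule ℂ V)} {H : Submodule ℂ V} (hH : H ∈ 𝒜) :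
    H ∈ intersectionLattice 𝒜 :=
  ⟨{H}, by simpa using hH, Set.finite_singleton _, by simp⟩

theorem inf_mem_intersectionLattice {𝒜 : Set (Submodule ℂ V)} {X Y : Submodule ℂ V}
    (hX : X ∈ intersectionLattice 𝒜) (hY : Y ∈ intersectionLattice 𝒜) :
    X ⊓ Y ∈ intersectionLattice 𝒜 := by
  obtain ⟨S, hS, hSf, rfl⟩ := hX
  obtain ⟨T, hT, hTf, rfl⟩ := hY
  exact ⟨S ∪ T, Set.union_subset hS hT, hSf.union hTf, sInf_union.symm⟩

/-- If `X` and `Y` lie in a common proper subspace, but in no common member of `𝒜`, then `X + Y`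
is not an intersection of members of `𝒜`. -/
theorem not_isModular {𝒜 : Set (Submodule ℂ V)} {X Y K : Submodule ℂ V}
    (hY : Y ∈ intersectionLattice 𝒜) (hXK : X ≤ K) (hYK : Y ≤ K) (hK : K ≠ ⊤)
    (h : ∀ H ∈ 𝒜, X ≤ H → ¬ Y ≤ H) : ¬ IsModular 𝒜 X := by
  intro hX
  obtain ⟨S, hS, -, hXY⟩ := hX.2 Y hY
  rcases S.eq_empty_or_nonempty with rfl | ⟨H, hH⟩
  · rw [sInf_empty] at hXY
    exact hK (top_le_iff.1 (hXY ▸ sup_le hXK hYK))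
  · have : X ⊔ Y ≤ H := hXY ▸ sInf_le hH
    exact h H (hS hH) (le_sup_left.trans this) (le_sup_right.trans this)

variable [FiniteDimensional ℂ V]

theorem finrank_add_rank (X : Submodule ℂ V) :
    Module.finrank ℂ X + rank X = Module.finrank ℂ V := by
  rw [add_comm]
  exact Submodule.finrank_quotient_add_finrank X

theorem rank_lt_rank {X Y : Submodule ℂ V} (h : X < Y) : rank Y < rank X := by
  have := Submodule.finrank_lt_finrank_of_lt h
  have := finrank_add_rank X
  have := finrank_add_rank Y
  omega

theorem eq_of_le_of_rank_le {X Y : Submodule ℂ V} (h : X ≤ Y) (hr : rank X ≤ rank Y) : X = Y := by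
  by_contra hne
  exact absurd (rank_lt_rank (lt_of_le_of_ne h hne)) (by omega)

theorem rank_top : rank (⊤ : Submodule ℂ V) = 0 := by
  have := finrank_add_rank (⊤ : Submodule ℂ V)
  rw [finrank_top] at this
  omega

theorem rank_inf_of_ne {H₁ H₂ : Submodule ℂ V} (h₁ : rank H₁ = 1) (h₂ : rank H₂ = 1)
    (hne : H₁ ≠ H₂) : 2 ≤ rank (H₁ ⊓ H₂) := by
  by_contra hlt
  have h : H₁ ⊓ H₂ = H₁ := eq_of_le_of_rank_le inf_le_left (by omega)
  exact hne (eq_of_le_of_rank_le (inf_eq_left.1 h) (by omega))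

/-- An element of rank `2` of the intersection lattice of an arrangement of hyperplanes is the
intersection of two of them. -/
theorem exists_eq_inf_of_rank_eq_two {𝒜 : Set (Submodule ℂ V)} (h𝒜 : ∀ H ∈ 𝒜, rank H = 1)
    {X : Submodule ℂ V} (hX : X ∈ intersectionLattice 𝒜) (hr : rank X = 2) :
    ∃ H₁ ∈ 𝒜, ∃ H₂ ∈ 𝒜, H₁ ≠ H₂ ∧ X = H₁ ⊓ H₂ := by
  obtain ⟨S, hS, -, rfl⟩ := hX
  have hne : S.Nonempty := by
    by_contra h
    rw [Set.not_nonempty_iff_eq_empty.1 h, sInf_empty, rank_top] at hr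
    omega
  obtain ⟨H₁, hH₁⟩ := hne
  have h₁ := h𝒜 _ (hS hH₁)
  obtain ⟨H₂, hH₂, hle⟩ : ∃ H₂ ∈ S, ¬ H₁ ≤ H₂ := by
    by_contra! h
    rw [le_antisymm (sInf_le hH₁) (le_sInf h), h₁] at hr
    omega
  have h₂ := h𝒜 _ (hS hH₂)
  have h12 : H₁ ≠ H₂ := fun h => hle h.le
  exact ⟨H₁, hS hH₁, H₂, hS hH₂, h12, eq_of_le_of_rank_le
    (le_inf (sInf_le hH₁) (sInf_le hH₂)) (hr ▸ rank_inf_of_ne h₁ h₂ h12)⟩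

/-- The rank grows by at least one at each of the `r` steps and ends at `r`. Counting from the start
gives `rank (X i) ≥ i`, counting from the end gives `rank (X i) ≤ i`, so `X 2` would be a modular
element of rank 2. -/
theorem not_isSupersolvable {𝒜 : Set (Submodule ℂ V)} (hr : 2 ≤ rank (sInf 𝒜))
    (h : ¬ ∃ X, IsModular 𝒜 X ∧ rank X = 2) : ¬ IsSupersolvable 𝒜 := by
  rintro ⟨X, h0, hlast, hlt, hmod⟩
  have hlow : ∀ i ≤ rank (sInf 𝒜), i ≤ rank (X i) := by
    intro i
    induction i with
    | zero => simp
    | succ i ih =>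
      intro hi
      have := ih (by omega)
      have := rank_lt_rank (hlt i (by omega))
      omega
  have hhigh : ∀ j ≤ rank (sInf 𝒜), rank (X (rank (sInf 𝒜) - j)) + j ≤ rank (sInf 𝒜) := by
    intro j
    induction j with
    | zero => simp [hlast]
    | succ j ih =>
      intro hj
      have h1 := ih (by omega)
      have h2 := rank_lt_rank (hlt (rank (sInf 𝒜) - (j + 1)) (by omega))
      rw [show rank (sInf 𝒜) - (j + 1) + 1 = rank (sInf 𝒜) - j by omega] at h2
      omega
  have h1 := hhigh (rank (sInf 𝒜) - 2) (by omega)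
  rw [show rank (sInf 𝒜) - (rank (sInf 𝒜) - 2) = 2 by omega] at h1
  have h2 := hlow 2 hr
  exact h ⟨X 2, hmod 2 hr, by omega⟩

/-- The conclusions for a group follow from those for a group that is equal to it up to a linear
change of coordinates. -/
theorem IsLinearlyConjugate.no_modular_rank_two {W : Subgroup (V ≃ₗ[ℂ] V)}
    {W' : Subgroup (V' ≃ₗ[ℂ] V')} (hc : IsLinearlyConjugate W W')
    (h : ∀ X, IsModular (reflectionArrangement W') X → rank X ≠ 2)
    (hne : (reflectionArrangement W').Nontrivial) :
    (¬ ∃ X : Submodule ℂ V, IsModular (reflectionArrangement W) X ∧ rank X = 2) ∧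
      ¬ IsSupersolvable (reflectionArrangement W) := by
  obtain ⟨φ, hφ⟩ := hc
  have hno : ¬ ∃ X : Submodule ℂ V, IsModular (reflectionArrangement W) X ∧ rank X = 2 := by
    rintro ⟨X, hX, hr⟩
    exact h _ (hX.map hφ) (by rw [rank_map, hr])
  refine ⟨hno, not_isSupersolvable ?_ hno⟩
  -- Two distinct hyperplanes force the rank of the arrangement to be at least 2.
  obtain ⟨H₁, h₁, H₂, h₂, h12⟩ := hne
  have h₁' := map_mem_reflectionArrangement (IsLinearlyConjugate.symm hφ) h₁
  have h₂' := map_mem_reflectionArrangement (IsLinearlyConjugate.symm hφ) h₂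
  have hle := le_inf (sInf_le h₁') (sInf_le h₂')
  have hrk := rank_inf_of_ne h₁'.1 h₂'.1
    (fun h => h12 (Submodule.map_injective_of_injective φ.symm.injective h))
  have := finrank_add_rank (sInf (reflectionArrangement W))
  have := finrank_add_rank (H₁.map (φ.symm : V' →ₗ[ℂ] V) ⊓ H₂.map (φ.symm : V' →ₗ[ℂ] V))
  have := Submodule.finrank_mono hle
  omega

end Lattice

/-! ### Hyperplanes as kernels, and reflections that preserve a form. -/

section Functionals

variable {V : Type*} [AddCommGroup V] [Module ℂ V]

theorem rank_ker [FiniteDimensional ℂ V] {f : Module.Dual ℂ V} (hf : f ≠ 0) :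
    rank (LinearMap.ker f) = 1 := by
  rw [rank, f.quotKerEquivRange.finrank_eq, LinearMap.range_eq_top.2 (LinearMap.surjective hf),
    finrank_top, Module.finrank_self]

theorem exists_of_ker_inf_ker_le {f g k : Module.Dual ℂ V}
    (h : LinearMap.ker f ⊓ LinearMap.ker g ≤ LinearMap.ker k) :
    ∃ s t : ℂ, k = s • f + t • g := by
  have := mem_span_of_iInf_ker_le_ker (ι := Fin 2) (L := ![f, g]) (K := k) (by
    intro x hx
    refine h ?_
    simp only [Submodule.mem_iInf, Fin.forall_fin_succ] at hx
    simpa using hx)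
  rw [Matrix.range_cons, Matrix.range_cons, Matrix.range_empty, Set.union_empty,
    Set.singleton_union, Submodule.mem_span_pair] at this
  obtain ⟨s, t, h⟩ := this
  exact ⟨s, t, h.symm⟩

theorem exists_of_ker_inf_ker_inf_ker_le {f g l k : Module.Dual ℂ V}
    (h : LinearMap.ker f ⊓ LinearMap.ker g ⊓ LinearMap.ker l ≤ LinearMap.ker k) :
    ∃ s t r : ℂ, k = s • f + t • g + r • l := by
  have := mem_span_of_iInf_ker_le_ker (ι := Fin 3) (L := ![f, g, l]) (K := k) (by
    intro x hx
    refine h ?_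
    simp only [Submodule.mem_iInf, Fin.forall_fin_succ] at hx
    simpa [and_assoc] using hx)
  rw [Matrix.range_cons, Matrix.range_cons, Matrix.range_cons, Matrix.range_empty, Set.union_empty,
    Set.singleton_union, Set.singleton_union, Submodule.mem_span_triple] at this
  obtain ⟨s, t, r, h⟩ := this
  exact ⟨s, t, r, h.symm⟩

/-- A linear map whose fixed space is a hyperplane, and which preserves a form, given by a map `F`
to the dual space, moves all vectors along a line, on which `F` cuts out the fixed space. -/
theorem fixed_eq_ker_of_rank_eq_one [FiniteDimensional ℂ V] (F : V → Module.Dual ℂ V)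
    (hF : ∀ x y, F (x - y) = F x - F y) {w : V ≃ₗ[ℂ] V}
    (hw : ∀ x y, F (w x) (w y) = F x y)
    (hr : rank (LinearMap.fixedSubmodule (w : V →ₗ[ℂ] V)) = 1) {x : V}
    (hx : F (w x - x) x ≠ 0) :
    LinearMap.fixedSubmodule (w : V →ₗ[ℂ] V) = LinearMap.ker (F (w x - x)) ∧
      ∀ y, w y = y + (F (w x - x) y / F (w x - x) x) • (w x - x) := by
  -- For a fixed vector `y`, invariance gives `F (w x) y = F (w x) (w y) = F x y`. Both sides of the
  -- inclusion are hyperplanes, hence equal.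
  have hle : LinearMap.fixedSubmodule (w : V →ₗ[ℂ] V) ≤ LinearMap.ker (F (w x - x)) := by
    intro y hy
    have hy : w y = y := by simpa using hy
    have := hw x y
    rw [hy] at this
    simp [hF, this]
  have heq : LinearMap.fixedSubmodule (w : V →ₗ[ℂ] V) = LinearMap.ker (F (w x - x)) := by
    refine eq_of_le_of_rank_le hle ?_
    rw [hr, rank_ker]
    rintro h
    simp [h] at hx
  refine ⟨heq, fun y => ?_⟩
  -- Subtracting the right multiple of `x` projects `y` to the fixed hyperplane; hence `w` is
  -- determined by its value at `x` alone.
  have hmem : y - (F (w x - x) y / F (w x - x) x) • x ∈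
      LinearMap.fixedSubmodule (w : V →ₗ[ℂ] V) := by
    rw [heq]
    simp [hx]
  have : w (y - (F (w x - x) y / F (w x - x) x) • x) =
      y - (F (w x - x) y / F (w x - x) x) • x := by simpa using hmem
  rw [map_sub, map_smul] at this
  rw [sub_eq_iff_eq_add] at this
  rw [this, smul_sub]
  abel

end Functionals

/-! ### Decidable criteria over quadratic rings, in a form suited to kernel evaluation. -/

section FiniteCheck

section Evaluation

variable {a b : ℤ} {β : Type*}

/-- Vectors with four coordinates, as a structure for the sake of fast evaluation. -/
@[ext]
structure Quad (R : Type*) where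
  c₀ : R
  c₁ : R
  c₂ : R
  c₃ : R

namespace Quad

variable {R : Type*}

instance [Sub R] : Sub (Quad R) :=
  ⟨fun x y => ⟨x.c₀ - y.c₀, x.c₁ - y.c₁, x.c₂ - y.c₂, x.c₃ - y.c₃⟩⟩

instance [Mul R] : SMul R (Quad R) :=
  ⟨fun r x => ⟨r * x.c₀, r * x.c₁, r * x.c₂, r * x.c₃⟩⟩

/-- The coordinates as a function. -/
def coord (x : Quad R) : Fin 4 → R := ![x.c₀, x.c₁, x.c₂, x.c₃]

@[simp] theorem coord_zero (x : Quad R) : x.coord 0 = x.c₀ := rfl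
@[simp] theorem coord_one (x : Quad R) : x.coord 1 = x.c₁ := rfl
@[simp] theorem coord_two (x : Quad R) : x.coord 2 = x.c₂ := rfl
@[simp] theorem coord_three (x : Quad R) : x.coord 3 = x.c₃ := rfl

end Quad

/-- `evalNat n f` is `f n`, but its reduction starts with the evaluation of `n`. -/
def evalNat (n : ℕ) (f : ℕ → β) : β := Nat.casesOn (motive := fun _ => β) n (f 0) fun k => f (k + 1)

/-- `evalInt n f` is `f n`, but its reduction starts with the evaluation of `n`. -/
def evalInt (n : ℤ) (f : ℤ → β) : β :=
  Int.casesOn (motive := fun _ => β) n (fun k => evalNat k fun k => f (Int.ofNat k))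
    fun k => evalNat k fun k => f (Int.negSucc k)

/-- `evalScalar r f` is `f r`, but its reduction starts with the evaluation of `r`. -/
def evalScalar (r : QuadraticAlgebra ℤ a b) (f : QuadraticAlgebra ℤ a b → β) : β :=
  evalInt r.re fun m => evalInt r.im fun n => f ⟨m, n⟩

/-- `evalQuad x f` is `f x`, but its reduction starts with the evaluation of `x`. -/
def evalQuad (x : Quad (QuadraticAlgebra ℤ a b)) (f : Quad (QuadraticAlgebra ℤ a b) → β) : β :=
  evalScalar x.c₀ fun p => evalScalar x.c₁ fun q => evalScalar x.c₂ fun r =>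
    evalScalar x.c₃ fun s => f ⟨p, q, r, s⟩

/-- `evalList l f` is `f l`, but its reduction starts with the evaluation of `l`. -/
def evalList : List (Quad (QuadraticAlgebra ℤ a b)) →
    (List (Quad (QuadraticAlgebra ℤ a b)) → β) → β
  | [], f => f []
  | x :: l, f => evalQuad x fun x => evalList l fun l => f (x :: l)

-- The `eval` functions force an argument to a literal before it is substituted, so that lazy
-- reduction does not duplicate an unevaluated computation. These equations erase them in proofs.
@[simp] theorem evalNat_eq (n : ℕ) (f : ℕ → β) : evalNat n f = f n := by cases n <;> rfl

@[simp] theorem evalInt_eq (n : ℤ) (f : ℤ → β) : evalInt n f = f n := by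
  cases n <;> simp [evalInt]

@[simp] theorem evalScalar_eq (r : QuadraticAlgebra ℤ a b) (f : QuadraticAlgebra ℤ a b → β) :
    evalScalar r f = f r := by simp [evalScalar]

@[simp] theorem evalQuad_eq (x : Quad (QuadraticAlgebra ℤ a b))
    (f : Quad (QuadraticAlgebra ℤ a b) → β) : evalQuad x f = f x := by simp [evalQuad]

@[simp] theorem evalList_eq (l : List (Quad (QuadraticAlgebra ℤ a b)))
    (f : List (Quad (QuadraticAlgebra ℤ a b)) → β) : evalList l f = f l := by
  induction l generalizing f with
  | nil => rfl
  | cons x l ih => simp [evalList, ih]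

/-- Equality of elements of a quadratic algebra. -/
def eqScalar (x y : QuadraticAlgebra ℤ a b) : Bool := Int.beq' x.re y.re && Int.beq' x.im y.im

/-- Equality of vectors. -/
def eqQuad (x y : Quad (QuadraticAlgebra ℤ a b)) : Bool :=
  eqScalar x.c₀ y.c₀ && eqScalar x.c₁ y.c₁ && eqScalar x.c₂ y.c₂ && eqScalar x.c₃ y.c₃

/-- The vanishing of all `2 × 2` minors of a pair of vectors. -/
def proportional (x y : Quad (QuadraticAlgebra ℤ a b)) : Bool :=
  eqScalar (x.c₀ * y.c₁) (x.c₁ * y.c₀) && eqScalar (x.c₀ * y.c₂) (x.c₂ * y.c₀) &&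
  eqScalar (x.c₀ * y.c₃) (x.c₃ * y.c₀) && eqScalar (x.c₁ * y.c₂) (x.c₂ * y.c₁) &&
  eqScalar (x.c₁ * y.c₃) (x.c₃ * y.c₁) && eqScalar (x.c₂ * y.c₃) (x.c₃ * y.c₂)

/-- A test that detects some cases in which `x` is not divisible by `y`, by means of the norm. -/
def notDvdScalar (y x : QuadraticAlgebra ℤ a b) : Bool :=
  evalInt (y.re * y.re + b * (y.re * y.im) - a * (y.im * y.im)) fun n =>
    !(Int.beq' (((y.re + b * y.im) * x.re - a * (y.im * x.im)) % n) 0 &&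
      Int.beq' ((y.re * x.im - y.im * x.re) % n) 0)

/-- A test that detects some cases in which `x` is not a multiple of `y`. -/
def notDvdQuad (y : QuadraticAlgebra ℤ a b) (x : Quad (QuadraticAlgebra ℤ a b)) : Bool :=
  notDvdScalar y x.c₀ || notDvdScalar y x.c₁ || notDvdScalar y x.c₂ || notDvdScalar y x.c₃

@[simp] theorem eqScalar_iff {x y : QuadraticAlgebra ℤ a b} : eqScalar x y = true ↔ x = y := by
  simp [eqScalar, QuadraticAlgebra.ext_iff]

@[simp] theorem eqQuad_iff {x y : Quad (QuadraticAlgebra ℤ a b)} : eqQuad x y = true ↔ x = y := by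
  simp [eqQuad, Quad.ext_iff, and_assoc]

theorem proportional_iff {x y : Quad (QuadraticAlgebra ℤ a b)} :
    proportional x y = true ↔ ∀ i j, x.coord i * y.coord j = x.coord j * y.coord i := by
  simp only [proportional, Bool.and_eq_true, eqScalar_iff]
  constructor
  · rintro ⟨⟨⟨⟨⟨h1, h2⟩, h3⟩, h4⟩, h5⟩, h6⟩ i j
    fin_cases i <;> fin_cases j <;> simp_all
  · intro h
    exact ⟨⟨⟨⟨⟨h 0 1, h 0 2⟩, h 0 3⟩, h 1 2⟩, h 1 3⟩, h 2 3⟩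

/-- If `x = y * z`, multiplying by the conjugate of `y` gives `N(y) * z`, so the norm divides both
coordinates of the conjugate of `y` times `x`. The test finds a coordinate for which this fails. -/
theorem not_dvd_of_notDvdScalar {y x : QuadraticAlgebra ℤ a b} (h : notDvdScalar y x = true) :
    ¬ y ∣ x := by
  rintro ⟨z, rfl⟩
  have h1 : (y.re + b * y.im) * (y * z).re - a * (y.im * (y * z).im) =
      (y.re * y.re + b * (y.re * y.im) - a * (y.im * y.im)) * z.re := by
    simp only [QuadraticAlgebra.re_mul, QuadraticAlgebra.im_mul]
    ring
  have h2 : y.re * (y * z).im - y.im * (y * z).re =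
      (y.re * y.re + b * (y.re * y.im) - a * (y.im * y.im)) * z.im := by
    simp only [QuadraticAlgebra.re_mul, QuadraticAlgebra.im_mul]
    ring
  simp only [notDvdScalar, evalInt_eq, h1, h2] at h
  simp at h

theorem not_dvd_of_notDvdQuad {y : QuadraticAlgebra ℤ a b} {x : Quad (QuadraticAlgebra ℤ a b)}
    (h : notDvdQuad y x = true) (z : Quad (QuadraticAlgebra ℤ a b)) : y • z ≠ x := by
  rintro rfl
  simp only [notDvdQuad, Bool.or_eq_true] at h
  rcases h with ((h | h) | h) | h <;> exact not_dvd_of_notDvdScalar h (dvd_mul_right _ _)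

/-- Every member of the list but the last is related to a later one. -/
def linked {α : Type*} (r : α → α → Bool) : List α → Bool
  | [] => true
  | [_] => true
  | x :: y :: l => (y :: l).any (r x) && linked r (y :: l)

/-- The list is a spanning tree read from its root at the end: each member inherits `P` from a later
one. -/
theorem linked_induction {α : Type*} {r : α → α → Bool} {P : α → Prop}
    (hr : ∀ x y, r x y = true → P y → P x) :
    ∀ l : List α, linked r l = true → (∀ x ∈ l.getLast?, P x) → ∀ x ∈ l, P x
  | [], _, _ => by simp
  | [a], _, h => by simpa using h
  | a :: b :: l, hl, h => by
    rw [linked, Bool.and_eq_true] at hl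
    have ih := linked_induction hr (b :: l) hl.2 (by simpa using h)
    intro x hx
    rcases List.mem_cons.1 hx with rfl | hx
    · obtain ⟨z, hz, hxz⟩ := List.any_eq_true.1 hl.1
      exact hr _ _ hxz (ih z hz)
    · exact ih x hx

end Evaluation

/-- Data for a finite verification of the reflection arrangement of a group of linear
transformations of a space of dimension four that is generated by reflections
`x ↦ x - form a x • a`, in the coordinates for a basis of roots: an involution of the ring of
coefficients, a sesquilinear form, the roots of the generators, one root for each hyperplane with
that of the first coordinate axis at the end, and the units by which roots on the same line
differ. -/
structure ReflectionData (a b : ℤ) where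
  bar : QuadraticAlgebra ℤ a b → QuadraticAlgebra ℤ a b
  form : Quad (QuadraticAlgebra ℤ a b) → Quad (QuadraticAlgebra ℤ a b) → QuadraticAlgebra ℤ a b
  roots : List (Quad (QuadraticAlgebra ℤ a b))
  units : List (QuadraticAlgebra ℤ a b)

namespace ReflectionData

variable {a b : ℤ} (D : ReflectionData a b)

/-- The basis of simple roots. -/
def simple : List (Quad (QuadraticAlgebra ℤ a b)) :=
  [⟨1, 0, 0, 0⟩, ⟨0, 1, 0, 0⟩, ⟨0, 0, 1, 0⟩, ⟨0, 0, 0, 1⟩]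

/-- The first simple root. -/
def base : Quad (QuadraticAlgebra ℤ a b) := ⟨1, 0, 0, 0⟩

/-- All unit multiples of the roots. -/
def allRoots : List (Quad (QuadraticAlgebra ℤ a b)) :=
  D.units.flatMap fun u => D.roots.map fun x => u • x

/-- The image of `x` under the reflection with root `r`. -/
def reflect (r x : Quad (QuadraticAlgebra ℤ a b)) : Quad (QuadraticAlgebra ℤ a b) :=
  x - D.form r x • r

/-- The simple roots are unit multiples of roots in the list. -/
def simpleListed : Bool := simple.all fun x => D.allRoots.any (eqQuad x)

/-- The generators permute the lines spanned by the roots. -/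
def closed : Bool :=
  evalList D.allRoots fun l => D.roots.all fun x => simple.all fun r =>
    evalQuad (D.reflect r x) fun y => l.any (eqQuad y)

/-- The lines spanned by the roots form one orbit. -/
def transitive : Bool :=
  linked (fun x y => simple.any fun r => evalQuad (D.reflect r y) fun z =>
    D.units.any fun u => eqQuad z (u • x)) D.roots

/-- A reflection that maps the base root to another root belongs to one of the hyperplanes of the
list of roots, or does not preserve the lattice spanned by the roots. -/
def reflectionsListed : Bool :=
  evalList D.allRoots fun l => l.all fun x => evalQuad (x - base) fun v =>
    eqQuad x base || evalScalar (D.form v base) fun r => !eqScalar r 0 &&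
    ((simple.any fun y => notDvdQuad r (D.form v y • v)) || D.roots.any (proportional v))

/-- For every line spanned by a root `x` other than the base root, the plane of these two roots
meets the hyperplane orthogonal to some root in a line that contains no root. -/
def planesNotModular : Bool :=
  D.roots.all fun x => proportional x base || D.roots.any fun u =>
    evalScalar (D.form base u) fun r => !eqScalar r 0 &&
    evalQuad (D.bar (D.form x u) • base - D.bar r • x) fun v =>
      D.roots.all fun y => !proportional v y

end ReflectionData

end FiniteCheck

/-- A realization of the data by reflections of a complex vector space, which leave a sesquilinear
form invariant. -/
structure ReflectionData.Realization {a b : ℤ} (D : ReflectionData a b) (V : Type*)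
    [AddCommGroup V] [Module ℂ V] where
  toC : QuadraticAlgebra ℤ a b →+* ℂ
  toC_injective : Function.Injective toC
  toC_bar : ∀ r, toC (D.bar r) = conj (toC r)
  basis : Module.Basis (Fin 4) ℂ V
  form : V →ₗ⋆[ℂ] Module.Dual ℂ V
  form_embed : ∀ x y : Quad (QuadraticAlgebra ℤ a b),
    form (∑ i, toC (x.coord i) • basis i) (∑ i, toC (y.coord i) • basis i) = toC (D.form x y)
  eq_zero_of_form : ∀ x, form x = 0 → x = 0
  refl : Fin 4 → V ≃ₗ[ℂ] V
  refl_apply : ∀ i x, refl i x = x - form (basis i) x • basis i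
  -- This is the condition for the reflections to preserve the form. If `form = (1 - ζ) h` with `h`
  -- Hermitian and `h(eᵢ, eᵢ) = 1`, then `form eᵢ eᵢ - 1 = -ζ` is the quotient of `1 - ζ` by its
  -- conjugate, for `ζ ≠ 1` of absolute value 1. For `ζ = -1` it says that the form is Hermitian on
  -- such pairs.
  form_apply_basis : ∀ x i,
    form x (basis i) = conj (form (basis i) x) * (form (basis i) (basis i) - 1)
  getLast : D.roots.getLast? = some ReflectionData.base
  units_mul : ∀ u ∈ D.units, ∀ u' ∈ D.units, u * u' ∈ D.units
  units_ne_zero : ∀ u ∈ D.units, u ≠ 0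
  simpleListed : D.simpleListed = true
  closed : D.closed = true
  transitive : D.transitive = true
  reflectionsListed : D.reflectionsListed = true
  planesNotModular : D.planesNotModular = true
  line_mem : (ℂ ∙ basis 0) ∈ intersectionLattice
    {H | ∃ x ∈ D.roots, H = LinearMap.ker (form (∑ i, toC (x.coord i) • basis i))}

/-! ### From the finite checks to the arrangement of the group. -/

namespace ReflectionData.Realization

variable {a b : ℤ} {D : ReflectionData a b} {V : Type*} [AddCommGroup V] [Module ℂ V]
  (A : D.Realization V)

/-- The vector with given coordinates. -/
def embed (x : Quad (QuadraticAlgebra ℤ a b)) : V := ∑ i, A.toC (x.coord i) • A.basis i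

/-- The group generated by the reflections. -/
def group : Subgroup (V ≃ₗ[ℂ] V) := Subgroup.closure (Set.range A.refl)

/-- The hyperplanes of the listed roots. -/
def hyperplanes : Set (Submodule ℂ V) :=
  {H | ∃ x ∈ D.roots, H = LinearMap.ker (A.form (A.embed x))}

/-- The roots, as vectors. -/
def rootSet : Set V := A.embed '' {x | x ∈ D.allRoots}

theorem form_embed' (x y : Quad (QuadraticAlgebra ℤ a b)) :
    A.form (A.embed x) (A.embed y) = A.toC (D.form x y) := A.form_embed x y

theorem repr_embed (x : Quad (QuadraticAlgebra ℤ a b)) (i : Fin 4) :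
    A.basis.repr (A.embed x) i = A.toC (x.coord i) := by
  rw [embed, Module.Basis.repr_sum_self]

theorem embed_injective : Function.Injective A.embed := by
  intro x y h
  have h' : ∀ i, x.coord i = y.coord i := fun i => A.toC_injective (by
    rw [← A.repr_embed, ← A.repr_embed, h])
  exact Quad.ext (h' 0) (h' 1) (h' 2) (h' 3)

theorem embed_sub (x y : Quad (QuadraticAlgebra ℤ a b)) :
    A.embed (x - y) = A.embed x - A.embed y := by
  have h : ∀ i, (x - y).coord i = x.coord i - y.coord i := by
    intro i; fin_cases i <;> rfl
  simp only [embed, h, map_sub, sub_smul, Finset.sum_sub_distrib]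

theorem embed_smul (r : QuadraticAlgebra ℤ a b) (x : Quad (QuadraticAlgebra ℤ a b)) :
    A.embed (r • x) = A.toC r • A.embed x := by
  have h : ∀ i, (r • x).coord i = r * x.coord i := by
    intro i; fin_cases i <;> rfl
  simp only [embed, h, map_mul, mul_smul, Finset.smul_sum]

theorem embed_base : A.embed base = A.basis 0 := by
  simp [embed, Fin.sum_univ_four, base]

theorem exists_embed_eq_basis (i : Fin 4) : ∃ r ∈ simple, A.embed r = A.basis i := by
  fin_cases i
  · exact ⟨⟨1, 0, 0, 0⟩, by simp [simple], by simp [embed, Fin.sum_univ_four]⟩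
  · exact ⟨⟨0, 1, 0, 0⟩, by simp [simple], by simp [embed, Fin.sum_univ_four]⟩
  · exact ⟨⟨0, 0, 1, 0⟩, by simp [simple], by simp [embed, Fin.sum_univ_four]⟩
  · exact ⟨⟨0, 0, 0, 1⟩, by simp [simple], by simp [embed, Fin.sum_univ_four]⟩

theorem exists_basis_eq_embed {r : Quad (QuadraticAlgebra ℤ a b)} (hr : r ∈ simple) :
    ∃ i, A.embed r = A.basis i := by
  simp only [simple, List.mem_cons, List.not_mem_nil, or_false] at hr
  rcases hr with rfl | rfl | rfl | rfl
  · exact ⟨0, by simp [embed, Fin.sum_univ_four]⟩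
  · exact ⟨1, by simp [embed, Fin.sum_univ_four]⟩
  · exact ⟨2, by simp [embed, Fin.sum_univ_four]⟩
  · exact ⟨3, by simp [embed, Fin.sum_univ_four]⟩

theorem refl_embed {r : Quad (QuadraticAlgebra ℤ a b)} {i : Fin 4} (h : A.embed r = A.basis i)
    (x : Quad (QuadraticAlgebra ℤ a b)) : A.refl i (A.embed x) = A.embed (D.reflect r x) := by
  rw [reflect, embed_sub, embed_smul, refl_apply, ← h, form_embed']

theorem mem_allRoots {x : Quad (QuadraticAlgebra ℤ a b)} :
    x ∈ D.allRoots ↔ ∃ u ∈ D.units, ∃ y ∈ D.roots, u • y = x := by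
  simp [allRoots]

theorem form_map {w : V ≃ₗ[ℂ] V} (hw : w ∈ A.group) (x y : V) :
    A.form (w x) (w y) = A.form x y := by
  induction hw using Subgroup.closure_induction generalizing x y with
  | mem w hw =>
    obtain ⟨i, rfl⟩ := hw
    simp only [refl_apply, map_sub, LinearMap.sub_apply, map_smul, LinearMap.map_smulₛₗ,
      LinearMap.smul_apply, smul_eq_mul, A.form_apply_basis x i]
    ring
  | one => rfl
  | mul v w _ _ hv hw => rw [LinearEquiv.mul_apply, LinearEquiv.mul_apply, hv, hw]
  | inv w _ hw =>
    rw [← hw (w⁻¹ x) (w⁻¹ y), ← LinearEquiv.mul_apply, ← LinearEquiv.mul_apply, mul_inv_cancel]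
    rfl

theorem map_ker {w : V ≃ₗ[ℂ] V} (hw : w ∈ A.group) (x : V) :
    (LinearMap.ker (A.form x)).map (w : V →ₗ[ℂ] V) = LinearMap.ker (A.form (w x)) := by
  ext y
  rw [Submodule.mem_map_equiv, LinearMap.mem_ker, LinearMap.mem_ker, ← A.form_map hw x,
    LinearEquiv.apply_symm_apply]

theorem ker_form_smul {c : ℂ} (hc : c ≠ 0) (x : V) :
    LinearMap.ker (A.form (c • x)) = LinearMap.ker (A.form x) := by
  rw [LinearMap.map_smulₛₗ, LinearMap.ker_smul _ _ (by simpa using hc)]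

open scoped Pointwise in
theorem map_mem_rootSet {w : V ≃ₗ[ℂ] V} (hw : w ∈ A.group) {x : V} (hx : x ∈ A.rootSet) :
    w x ∈ A.rootSet := by
  have hfin : A.rootSet.Finite := (List.finite_toSet D.allRoots).image _
  have hle : A.group ≤ MulAction.stabilizer (V ≃ₗ[ℂ] V) A.rootSet := by
    rw [group, Subgroup.closure_le]
    rintro _ ⟨i, rfl⟩
    -- For a finite set, being mapped into itself is enough to be stabilized, so only the generators
    -- themselves need checking.
    rw [SetLike.mem_coe, MulAction.mem_stabilizer_set_iff_smul_set_subset hfin]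
    rintro _ ⟨_, ⟨x, hx, rfl⟩, rfl⟩
    obtain ⟨u, hu, y, hy, rfl⟩ := mem_allRoots.1 hx
    obtain ⟨r, hr, hri⟩ := A.exists_embed_eq_basis i
    have hc := A.closed
    simp only [ReflectionData.closed, evalList_eq, evalQuad_eq, List.all_eq_true, List.any_eq_true,
      eqQuad_iff] at hc
    obtain ⟨z, hz, hzy⟩ := hc y hy r hr
    obtain ⟨u', hu', z', hz', rfl⟩ := mem_allRoots.1 hz
    refine ⟨(u * u') • z', mem_allRoots.2 ⟨_, A.units_mul u hu u' hu', z', hz', rfl⟩, ?_⟩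
    change _ = A.refl i (A.embed (u • y))
    rw [embed_smul, embed_smul, map_smul, A.refl_embed hri, hzy, embed_smul, map_mul, mul_smul]
  have := hle hw
  rw [MulAction.mem_stabilizer_iff] at this
  rw [← this]
  exact ⟨x, hx, rfl⟩

theorem basis_mem_rootSet (i : Fin 4) : A.basis i ∈ A.rootSet := by
  obtain ⟨r, hr, hri⟩ := A.exists_embed_eq_basis i
  have h := A.simpleListed
  simp only [ReflectionData.simpleListed, List.all_eq_true, List.any_eq_true, eqQuad_iff] at h
  obtain ⟨y, hy, rfl⟩ := h r hr
  exact ⟨r, hy, hri⟩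

theorem toC_ne_zero {u : QuadraticAlgebra ℤ a b} (hu : u ≠ 0) : A.toC u ≠ 0 :=
  (map_ne_zero_iff _ A.toC_injective).2 hu

/-- The group acts transitively on the lines spanned by the roots. -/
theorem exists_map_eq_smul {x : Quad (QuadraticAlgebra ℤ a b)} (hx : x ∈ D.roots) :
    ∃ g ∈ A.group, ∃ c : ℂ, c ≠ 0 ∧ g (A.embed x) = c • A.basis 0 := by
  refine linked_induction (P := fun x => ∃ g ∈ A.group, ∃ c : ℂ, c ≠ 0 ∧
    g (A.embed x) = c • A.basis 0) ?_ _ A.transitive ?_ x hx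
  · rintro x y hxy ⟨g, hg, c, hc, h⟩
    simp only [evalQuad_eq, List.any_eq_true, eqQuad_iff] at hxy
    obtain ⟨r, hr, u, hu, hxy⟩ := hxy
    obtain ⟨i, hi⟩ := A.exists_basis_eq_embed hr
    have hu' := A.toC_ne_zero (A.units_ne_zero u hu)
    have h1 : A.refl i (A.embed y) = A.toC u • A.embed x := by
      rw [A.refl_embed hi, hxy, embed_smul]
    have h2 : A.embed x = (A.toC u)⁻¹ • A.refl i (A.embed y) := by
      rw [h1, smul_smul, inv_mul_cancel₀ hu', one_smul]
    refine ⟨g * (A.refl i)⁻¹,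
      mul_mem hg (inv_mem (Subgroup.subset_closure ⟨i, rfl⟩)), (A.toC u)⁻¹ * c,
      mul_ne_zero (inv_ne_zero hu') hc, ?_⟩
    rw [h2, map_smul, LinearEquiv.mul_apply, ← LinearEquiv.mul_apply (A.refl i)⁻¹, inv_mul_cancel,
      LinearEquiv.coe_one, id, h, smul_smul]
  · intro x hx
    rw [A.getLast, Option.mem_some_iff] at hx
    exact ⟨1, one_mem _, 1, one_ne_zero, by rw [← hx, embed_base]; simp⟩

theorem basis_ne_zero (i : Fin 4) : A.basis i ≠ 0 := A.basis.ne_zero i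

theorem embed_ne_zero {x : Quad (QuadraticAlgebra ℤ a b)} (hx : x ∈ D.roots) :
    A.embed x ≠ 0 := by
  obtain ⟨g, -, c, hc, h⟩ := A.exists_map_eq_smul hx
  intro h0
  rw [h0, map_zero] at h
  exact smul_ne_zero hc (A.basis_ne_zero 0) h.symm

theorem exists_smul_of_proportional {x y : Quad (QuadraticAlgebra ℤ a b)}
    (h : proportional x y = true) (hy : A.embed y ≠ 0) : ∃ c : ℂ, A.embed x = c • A.embed y := by
  rw [proportional_iff] at h
  obtain ⟨j, hj⟩ : ∃ j, A.toC (y.coord j) ≠ 0 := by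
    by_contra! h0
    exact hy (by simp [embed, h0])
  refine ⟨A.toC (x.coord j) / A.toC (y.coord j), A.basis.repr.injective (Finsupp.ext fun i => ?_)⟩
  rw [map_smul, Finsupp.smul_apply, repr_embed, repr_embed, smul_eq_mul]
  have := congrArg A.toC (h i j)
  rw [map_mul, map_mul] at this
  field_simp
  linear_combination this

theorem map_mem_hyperplanes {w : V ≃ₗ[ℂ] V} (hw : w ∈ A.group) {H : Submodule ℂ V}
    (hH : H ∈ A.hyperplanes) : H.map (w : V →ₗ[ℂ] V) ∈ A.hyperplanes := by
  obtain ⟨x, hx, rfl⟩ := hH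
  rw [A.map_ker hw]
  obtain ⟨g, hg, c, hc, h⟩ := A.exists_map_eq_smul hx
  have hx' : A.embed x = c • g⁻¹ (A.basis 0) := by
    rw [← map_smul, ← h, ← LinearEquiv.mul_apply, inv_mul_cancel]
    rfl
  -- The units are not required to contain 1, so the listed root `x` need not lie in `rootSet`; the
  -- first basis vector does, and its orbit reaches the line of `x`.
  obtain ⟨y, hy, hyw⟩ := A.map_mem_rootSet (mul_mem hw (inv_mem hg)) (A.basis_mem_rootSet 0)
  obtain ⟨u, hu, z, hz, rfl⟩ := mem_allRoots.1 hy
  refine ⟨z, hz, ?_⟩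
  rw [hx', map_smul, A.ker_form_smul hc, ← LinearEquiv.mul_apply, ← hyw, embed_smul,
    A.ker_form_smul (A.toC_ne_zero (A.units_ne_zero u hu))]

theorem form_basis_ne_zero (i : Fin 4) : A.form (A.basis i) ≠ 0 := fun h =>
  A.basis_ne_zero i (A.eq_zero_of_form _ h)

theorem line_mem_intersectionLattice {x : Quad (QuadraticAlgebra ℤ a b)} (hx : x ∈ D.roots) :
    (ℂ ∙ A.embed x) ∈ intersectionLattice A.hyperplanes := by
  obtain ⟨g, hg, c, hc, h⟩ := A.exists_map_eq_smul hx
  have hx' : A.embed x = c • g⁻¹ (A.basis 0) := by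
    rw [← map_smul, ← h, ← LinearEquiv.mul_apply, inv_mul_cancel]
    rfl
  have := map_mem_intersectionLattice (φ := g⁻¹)
    (fun H hH => A.map_mem_hyperplanes (inv_mem hg) hH) A.line_mem
  rw [Submodule.map_span, Set.image_singleton] at this
  rw [hx', Submodule.span_singleton_smul_eq (IsUnit.mk0 c hc)]
  exact this

variable [FiniteDimensional ℂ V]

theorem ker_mem_reflectionArrangement (i : Fin 4) :
    LinearMap.ker (A.form (A.basis i)) ∈ reflectionArrangement A.group := by
  refine ⟨rank_ker (A.form_basis_ne_zero i), A.refl i, Subgroup.subset_closure ⟨i, rfl⟩, ?_⟩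
  ext x
  simp [refl_apply, A.basis_ne_zero i]

theorem hyperplanes_subset : A.hyperplanes ⊆ reflectionArrangement A.group := by
  rintro _ ⟨x, hx, rfl⟩
  obtain ⟨g, hg, c, hc, h⟩ := A.exists_map_eq_smul hx
  have hx' : A.embed x = c • g⁻¹ (A.basis 0) := by
    rw [← map_smul, ← h, ← LinearEquiv.mul_apply, inv_mul_cancel]
    rfl
  rw [hx', A.ker_form_smul hc, ← A.map_ker (inv_mem hg)]
  exact map_mem_reflectionArrangement (mem_conj_iff (inv_mem hg))
    (A.ker_mem_reflectionArrangement 0)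

/-- A reflection in the group that moves the base root has one of the listed hyperplanes. -/
theorem fixed_mem_hyperplanes {w : V ≃ₗ[ℂ] V} (hw : w ∈ A.group)
    (hr : rank (LinearMap.fixedSubmodule (w : V →ₗ[ℂ] V)) = 1) (hne : w (A.basis 0) ≠ A.basis 0) :
    LinearMap.fixedSubmodule (w : V →ₗ[ℂ] V) ∈ A.hyperplanes := by
  obtain ⟨x, hx, hxw⟩ := A.map_mem_rootSet hw (A.basis_mem_rootSet 0)
  have hv : A.embed (x - base) = w (A.basis 0) - A.basis 0 := by
    rw [embed_sub, hxw, embed_base]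
  have hl := A.reflectionsListed
  simp only [ReflectionData.reflectionsListed, evalList_eq, evalQuad_eq, evalScalar_eq,
    List.all_eq_true, Bool.or_eq_true, eqQuad_iff, Bool.and_eq_true, Bool.not_eq_true',
    List.any_eq_true] at hl
  obtain h0 | ⟨h0, h⟩ := hl x hx
  · rw [h0, embed_base] at hxw
    exact absurd hxw.symm hne
  rw [← Bool.not_eq_true, eqScalar_iff] at h0
  have h0' := A.toC_ne_zero h0
  have hform : ∀ y, A.form (w (A.basis 0) - A.basis 0) (A.embed y) =
      A.toC (D.form (x - base) y) := fun y => by rw [← hv, form_embed']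
  have hform0 : A.form (w (A.basis 0) - A.basis 0) (A.basis 0) =
      A.toC (D.form (x - base) base) := by rw [← hform, embed_base]
  obtain ⟨hfix, hwy⟩ := fixed_eq_ker_of_rank_eq_one A.form (fun x y => map_sub _ x y)
    (A.form_map hw) hr (x := A.basis 0) (by rwa [hform0])
  -- A reflection with `w e₀ = e₀ + v` moves a simple root `y` by `(form v y / form v e₀) • v`.
  -- Since `w` permutes the roots, this must have coefficients in the quadratic ring, which the
  -- first alternative contradicts. In the second, `v` spans the line of a listed root.
  rcases h with ⟨y, hy, h⟩ | ⟨y, hy, h⟩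
  · obtain ⟨i, hi⟩ := A.exists_basis_eq_embed hy
    obtain ⟨z, hz, hzw⟩ := A.map_mem_rootSet hw (A.basis_mem_rootSet i)
    refine absurd (A.embed_injective ?_) (not_dvd_of_notDvdQuad h (z - y))
    rw [embed_smul, embed_smul, embed_sub, hzw, hi, hwy (A.basis i), hform0, ← hi, hform,
      add_sub_cancel_left, smul_smul, mul_div_cancel₀ _ h0', hv]
  · obtain ⟨c, hc⟩ := A.exists_smul_of_proportional h (A.embed_ne_zero hy)
    refine ⟨y, hy, ?_⟩
    rw [hfix, ← hv, hc, A.ker_form_smul]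
    rintro rfl
    rw [zero_smul, hv] at hc
    exact hne (sub_eq_zero.1 hc)

/-- A reflection moves some basis root. By transitivity a conjugate of it moves the first one, where
`fixed_mem_hyperplanes` applies, and the listed hyperplanes are stable under the group. -/
theorem reflectionArrangement_eq : reflectionArrangement A.group = A.hyperplanes := by
  refine Set.Subset.antisymm ?_ A.hyperplanes_subset
  rintro _ ⟨hr, w, hw, rfl⟩
  obtain ⟨i, hi⟩ : ∃ i, w (A.basis i) ≠ A.basis i := by
    by_contra! h
    have : w = 1 := LinearEquiv.toLinearMap_injective (A.basis.ext h)
    have h1 : LinearMap.fixedSubmodule (w : V →ₗ[ℂ] V) = ⊤ := by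
      rw [this]
      ext
      simp
    rw [h1, rank_top] at hr
    omega
  obtain ⟨x, hx, hxi⟩ := A.basis_mem_rootSet i
  obtain ⟨u, hu, y, hy, rfl⟩ := mem_allRoots.1 hx
  obtain ⟨g, hg, c, hc, h⟩ := A.exists_map_eq_smul hy
  have hgi : g (A.basis i) = (A.toC u * c) • A.basis 0 := by
    rw [← hxi, embed_smul, map_smul, h, smul_smul]
  have huc : A.toC u * c ≠ 0 := mul_ne_zero (A.toC_ne_zero (A.units_ne_zero u hu)) hc
  have hw' : g * w * g⁻¹ ∈ A.group := mul_mem (mul_mem hg hw) (inv_mem hg)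
  have hmap : LinearMap.fixedSubmodule ((g * w * g⁻¹ : V ≃ₗ[ℂ] V) : V →ₗ[ℂ] V) =
      (LinearMap.fixedSubmodule (w : V →ₗ[ℂ] V)).map (g : V →ₗ[ℂ] V) := by
    ext z
    rw [Submodule.mem_map_equiv, LinearMap.mem_fixedSubmodule_iff,
      LinearMap.mem_fixedSubmodule_iff]
    exact (LinearEquiv.eq_symm_apply g).symm
  have hmem := A.fixed_mem_hyperplanes hw' (by rw [hmap, rank_map, hr]) (by
    intro h0
    have h1 : (g * w * g⁻¹) (g (A.basis i)) = g (A.basis i) := by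
      rw [hgi, map_smul, h0]
    rw [← LinearEquiv.mul_apply, inv_mul_cancel_right, LinearEquiv.mul_apply] at h1
    exact hi (g.injective h1))
  have := A.map_mem_hyperplanes (inv_mem hg) hmem
  rw [hmap] at this
  rwa [show ((g⁻¹ : V ≃ₗ[ℂ] V) : V →ₗ[ℂ] V) = (g.symm : V →ₗ[ℂ] V) from rfl,
    show (g : V →ₗ[ℂ] V) = (g.symm.symm : V →ₗ[ℂ] V) from rfl, map_symm_map g.symm] at this

/-- The witness `Y` is the line of the root `u` found by the check. Within the plane of the base
root and `x`, the vectors whose functional kills `u` form the line of `v = conj (form x u) • base -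
conj (form base u) • x`, which contains no root. -/
theorem not_isModular_of_base {x : Quad (QuadraticAlgebra ℤ a b)} (hx : x ∈ D.roots)
    (hne : LinearMap.ker (A.form (A.basis 0)) ≠ LinearMap.ker (A.form (A.embed x))) :
    ¬ IsModular (reflectionArrangement A.group)
      (LinearMap.ker (A.form (A.basis 0)) ⊓ LinearMap.ker (A.form (A.embed x))) := by
  rw [A.reflectionArrangement_eq]
  have hl := A.planesNotModular
  simp only [ReflectionData.planesNotModular, evalQuad_eq, evalScalar_eq, List.all_eq_true,
    Bool.or_eq_true, Bool.and_eq_true, Bool.not_eq_true', List.any_eq_true,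
    ← Bool.not_eq_true, eqScalar_iff] at hl
  obtain h | ⟨u, hu, h0, h⟩ := hl x hx
  · obtain ⟨c, hc⟩ := A.exists_smul_of_proportional h (by
      rw [embed_base]; exact A.basis_ne_zero 0)
    refine absurd ?_ hne
    rw [hc, embed_base, A.ker_form_smul]
    rintro rfl
    exact A.embed_ne_zero hx (by rw [hc, zero_smul])
  have h0' := A.toC_ne_zero h0
  have hbase : ∀ y, A.form (A.basis 0) (A.embed y) = A.toC (D.form base y) := fun y => by
    rw [← embed_base, form_embed']
  refine not_isModular (A.line_mem_intersectionLattice hu)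
    (K := LinearMap.ker (A.toC (D.form x u) • A.form (A.basis 0) -
      A.toC (D.form base u) • A.form (A.embed x))) ?_ ?_ ?_ ?_
  · rintro y ⟨h1, h2⟩
    have h1 : A.form (A.basis 0) y = 0 := h1
    have h2 : A.form (A.embed x) y = 0 := h2
    simp [h1, h2]
  · rw [Submodule.span_singleton_le_iff_mem, LinearMap.mem_ker]
    simp only [LinearMap.sub_apply, LinearMap.smul_apply, hbase, form_embed', smul_eq_mul]
    ring
  · intro hK
    rw [LinearMap.ker_eq_top, sub_eq_zero] at hK
    have hx0 : A.form (A.embed x) ≠ 0 := fun h0 => A.embed_ne_zero hx (A.eq_zero_of_form _ h0)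
    have h1 : A.toC (D.form x u) ≠ 0 := by
      intro h1
      rw [h1, zero_smul] at hK
      exact smul_ne_zero h0' hx0 hK.symm
    rw [← LinearMap.ker_smul _ _ h1, hK, LinearMap.ker_smul _ _ h0'] at hne
    exact hne rfl
  · rintro _ ⟨y, hy, rfl⟩ h1 h2
    rw [Submodule.span_singleton_le_iff_mem, LinearMap.mem_ker, form_embed'] at h2
    obtain ⟨s, t, hst⟩ := exists_of_ker_inf_ker_le h1
    have hu0 := congrArg (fun f => f (A.embed u)) hst
    simp only [LinearMap.add_apply, LinearMap.smul_apply, form_embed', hbase, h2,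
      smul_eq_mul] at hu0
    -- The form is nondegenerate and conjugate-linear in its first argument, so the relation between
    -- functionals becomes one between roots, with conjugated coefficients.
    have hy' : A.embed y = conj s • A.embed base + conj t • A.embed x := by
      refine sub_eq_zero.1 (A.eq_zero_of_form _ ?_)
      rw [map_sub, map_add, LinearMap.map_smulₛₗ, LinearMap.map_smulₛₗ, hst, embed_base]
      simp
    refine h y hy (proportional_iff.2 fun i j => A.toC_injective ?_)
    have hyi : ∀ i, A.toC (y.coord i) =
        conj s * A.toC (base.coord i) + conj t * A.toC (x.coord i) := fun i => by
      rw [← A.repr_embed, hy']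
      simp [repr_embed]
    have hvi : ∀ i, A.toC ((D.bar (D.form x u) • base - D.bar (D.form base u) • x).coord i) =
        conj (A.toC (D.form x u)) * A.toC (base.coord i) -
          conj (A.toC (D.form base u)) * A.toC (x.coord i) := fun i => by
      rw [← A.repr_embed, embed_sub, embed_smul, embed_smul, toC_bar, toC_bar]
      simp [repr_embed]
    have hu1 := congrArg conj hu0
    simp only [map_zero, map_add, map_mul] at hu1
    rw [map_mul, map_mul, hyi, hyi, hvi, hvi]
    -- Both `y` and `v` are combinations of the base root and `x`. Their minors are those of the
    -- base root and `x` times the determinant of the coefficients, which is the conjugate of `y`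
    -- paired with `u` up to sign, hence zero.
    linear_combination (A.toC (base.coord i) * A.toC (x.coord j) -
      A.toC (base.coord j) * A.toC (x.coord i)) * (-hu1)

theorem no_modular_rank_two (X : Submodule ℂ V)
    (hX : IsModular (reflectionArrangement A.group) X) : rank X ≠ 2 := by
  intro hr
  obtain ⟨H₁, h₁, H₂, h₂, hne, rfl⟩ :=
    exists_eq_inf_of_rank_eq_two (fun H hH => hH.1) hX.1 hr
  rw [A.reflectionArrangement_eq] at h₁
  obtain ⟨x, hx, rfl⟩ := h₁
  obtain ⟨g, hg, c, hc, h⟩ := A.exists_map_eq_smul hx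
  have h₂' := map_mem_reflectionArrangement (mem_conj_iff hg) h₂
  rw [A.reflectionArrangement_eq] at h₂'
  obtain ⟨y, hy, hy'⟩ := h₂'
  have h1 : (LinearMap.ker (A.form (A.embed x))).map (g : V →ₗ[ℂ] V) =
      LinearMap.ker (A.form (A.basis 0)) := by
    rw [A.map_ker hg, h, A.ker_form_smul hc]
  have hmod := hX.map (mem_conj_iff hg)
  rw [Submodule.map_inf _ g.injective, h1, hy'] at hmod
  refine A.not_isModular_of_base hy ?_ hmod
  rw [← h1, ← hy']
  exact fun h => hne (Submodule.map_injective_of_injective g.injective h)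

theorem nontrivial_reflectionArrangement : (reflectionArrangement A.group).Nontrivial := by
  refine ⟨_, A.ker_mem_reflectionArrangement 0, _, A.ker_mem_reflectionArrangement 1, fun h => ?_⟩
  obtain ⟨s, t, hst⟩ := exists_of_ker_inf_ker_le (f := A.form (A.basis 0))
    (g := A.form (A.basis 0)) (inf_le_left.trans h.le)
  have h1 : A.basis 1 - conj (s + t) • A.basis 0 = 0 := by
    refine A.eq_zero_of_form _ ?_
    rw [map_sub, LinearMap.map_smulₛₗ, hst]
    simp [add_smul]
  have := congrArg (fun v => A.basis.repr v 1) h1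
  simp at this

end ReflectionData.Realization

/-! ### Root data of H₄ and G₃₂, and the finite checks. -/

/-- The ring `ℤ[φ]` generated by the golden ratio. -/
abbrev GoldenInt := QuadraticAlgebra ℤ 1 1

/-- The ring `ℤ[ω]` of Eisenstein integers. -/
abbrev EisensteinInt := QuadraticAlgebra ℤ (-1) (-1)

/-- The reflections of type `H₄` in the basis of simple roots. -/
def dataH4 : ReflectionData 1 1 where
  bar x := x
  form x y := x.c₀ * (⟨2, 0⟩ * y.c₀ - y.c₁) + x.c₁ * (⟨2, 0⟩ * y.c₁ - y.c₀ - y.c₂) +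
    x.c₂ * (⟨2, 0⟩ * y.c₂ - y.c₁ - ⟨0, 1⟩ * y.c₃) + x.c₃ * (⟨2, 0⟩ * y.c₃ - ⟨0, 1⟩ * y.c₂)
  roots :=
    [⟨⟨0, 2⟩, ⟨1, 3⟩, ⟨2, 4⟩, ⟨2, 3⟩⟩, ⟨⟨1, 1⟩, ⟨1, 3⟩, ⟨2, 4⟩, ⟨2, 3⟩⟩,
     ⟨⟨1, 1⟩, ⟨2, 2⟩, ⟨2, 4⟩, ⟨2, 3⟩⟩, ⟨⟨1, 1⟩, ⟨2, 2⟩, ⟨3, 3⟩, ⟨2, 3⟩⟩,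
     ⟨⟨1, 1⟩, ⟨2, 2⟩, ⟨3, 3⟩, ⟨1, 3⟩⟩, ⟨⟨1, 1⟩, ⟨2, 2⟩, ⟨2, 3⟩, ⟨1, 3⟩⟩,
     ⟨⟨1, 1⟩, ⟨1, 2⟩, ⟨2, 3⟩, ⟨1, 3⟩⟩, ⟨⟨1, 1⟩, ⟨2, 2⟩, ⟨2, 3⟩, ⟨2, 2⟩⟩,
     ⟨⟨0, 1⟩, ⟨1, 2⟩, ⟨2, 3⟩, ⟨1, 3⟩⟩, ⟨⟨1, 1⟩, ⟨1, 2⟩, ⟨2, 3⟩, ⟨2, 2⟩⟩,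
     ⟨⟨0, 1⟩, ⟨1, 2⟩, ⟨2, 3⟩, ⟨2, 2⟩⟩, ⟨⟨1, 1⟩, ⟨1, 2⟩, ⟨1, 3⟩, ⟨2, 2⟩⟩,
     ⟨⟨0, 1⟩, ⟨1, 2⟩, ⟨1, 3⟩, ⟨2, 2⟩⟩, ⟨⟨1, 1⟩, ⟨1, 2⟩, ⟨1, 3⟩, ⟨1, 2⟩⟩,
     ⟨⟨1, 1⟩, ⟨1, 2⟩, ⟨2, 2⟩, ⟨1, 2⟩⟩, ⟨⟨0, 1⟩, ⟨0, 2⟩, ⟨1, 3⟩, ⟨2, 2⟩⟩,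
     ⟨⟨0, 1⟩, ⟨1, 2⟩, ⟨1, 3⟩, ⟨1, 2⟩⟩, ⟨⟨1, 1⟩, ⟨2, 1⟩, ⟨2, 2⟩, ⟨1, 2⟩⟩,
     ⟨⟨0, 1⟩, ⟨1, 2⟩, ⟨2, 2⟩, ⟨1, 2⟩⟩, ⟨⟨0, 1⟩, ⟨0, 2⟩, ⟨1, 3⟩, ⟨1, 2⟩⟩,
     ⟨1, ⟨2, 1⟩, ⟨2, 2⟩, ⟨1, 2⟩⟩, ⟨⟨0, 1⟩, ⟨1, 1⟩, ⟨2, 2⟩, ⟨1, 2⟩⟩,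
     ⟨⟨0, 1⟩, ⟨0, 2⟩, ⟨1, 2⟩, ⟨1, 2⟩⟩, ⟨⟨0, 1⟩, ⟨0, 2⟩, ⟨0, 2⟩, ⟨1, 1⟩⟩,
     ⟨1, ⟨1, 1⟩, ⟨2, 2⟩, ⟨1, 2⟩⟩, ⟨⟨0, 1⟩, ⟨1, 1⟩, ⟨1, 2⟩, ⟨1, 2⟩⟩,
     ⟨⟨0, 1⟩, ⟨0, 2⟩, ⟨1, 2⟩, ⟨1, 1⟩⟩, ⟨⟨0, 1⟩, ⟨0, 1⟩, ⟨0, 2⟩, ⟨1, 1⟩⟩,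
     ⟨⟨0, 1⟩, ⟨0, 1⟩, ⟨0, 1⟩, 1⟩, ⟨1, ⟨1, 1⟩, ⟨1, 2⟩, ⟨1, 2⟩⟩, ⟨⟨0, 1⟩, ⟨1, 1⟩, ⟨1, 2⟩, ⟨1, 1⟩⟩,
     ⟨0, ⟨0, 1⟩, ⟨0, 2⟩, ⟨1, 1⟩⟩, ⟨⟨0, 1⟩, ⟨0, 1⟩, ⟨1, 1⟩, ⟨1, 1⟩⟩, ⟨0, 0, 0, 1⟩,
     ⟨0, ⟨0, 1⟩, ⟨0, 1⟩, 1⟩, ⟨⟨0, 1⟩, ⟨0, 1⟩, ⟨0, 1⟩, ⟨0, 1⟩⟩, ⟨1, ⟨1, 1⟩, ⟨1, 2⟩, ⟨1, 1⟩⟩,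
     ⟨⟨0, 1⟩, ⟨1, 1⟩, ⟨1, 1⟩, ⟨1, 1⟩⟩, ⟨0, ⟨0, 1⟩, ⟨1, 1⟩, ⟨1, 1⟩⟩,
     ⟨⟨0, 1⟩, ⟨0, 1⟩, ⟨1, 1⟩, ⟨0, 1⟩⟩, ⟨0, 0, ⟨0, 1⟩, 1⟩, ⟨0, ⟨0, 1⟩, ⟨0, 1⟩, ⟨0, 1⟩⟩,
     ⟨1, ⟨1, 1⟩, ⟨1, 1⟩, ⟨1, 1⟩⟩, ⟨⟨0, 1⟩, ⟨1, 1⟩, ⟨1, 1⟩, ⟨0, 1⟩⟩, ⟨0, 1, ⟨1, 1⟩, ⟨1, 1⟩⟩,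
     ⟨0, ⟨0, 1⟩, ⟨1, 1⟩, ⟨0, 1⟩⟩, ⟨0, 0, ⟨0, 1⟩, ⟨0, 1⟩⟩, ⟨1, 1, ⟨1, 1⟩, ⟨1, 1⟩⟩,
     ⟨1, ⟨1, 1⟩, ⟨1, 1⟩, ⟨0, 1⟩⟩, ⟨0, 1, ⟨1, 1⟩, ⟨0, 1⟩⟩, ⟨0, 0, 1, ⟨0, 1⟩⟩,
     ⟨1, 1, ⟨1, 1⟩, ⟨0, 1⟩⟩, ⟨0, 1, 1, ⟨0, 1⟩⟩, ⟨0, 0, 1, 0⟩, ⟨1, 1, 1, ⟨0, 1⟩⟩, ⟨0, 1, 1, 0⟩,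
     ⟨1, 1, 1, 0⟩, ⟨0, 1, 0, 0⟩, ⟨1, 1, 0, 0⟩, ⟨1, 0, 0, 0⟩]
  units := [⟨1, 0⟩, ⟨-1, 0⟩]

/-- The conjugation of the ring of Eisenstein integers. -/
def eisensteinConj (x : EisensteinInt) : EisensteinInt := ⟨x.re - x.im, -x.im⟩

/-- The reflections of `G₃₂` in a basis of roots. -/
def dataG32 : ReflectionData (-1) (-1) where
  bar := eisensteinConj
  form x y := eisensteinConj x.c₀ * (⟨1, -1⟩ * y.c₀ - y.c₁) +
    eisensteinConj x.c₁ * (⟨0, 1⟩ * y.c₀ + ⟨1, -1⟩ * y.c₁ - y.c₂) +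
    eisensteinConj x.c₂ * (⟨0, 1⟩ * y.c₁ + ⟨1, -1⟩ * y.c₂ - y.c₃) +
    eisensteinConj x.c₃ * (⟨0, 1⟩ * y.c₂ + ⟨1, -1⟩ * y.c₃)
  roots :=
    [⟨⟨2, 1⟩, ⟨2, 0⟩, ⟨1, -1⟩, ⟨0, -1⟩⟩, ⟨⟨1, 1⟩, ⟨2, 1⟩, ⟨2, 0⟩, ⟨1, -1⟩⟩,
     ⟨1, ⟨2, 0⟩, ⟨1, -1⟩, ⟨0, -1⟩⟩, ⟨⟨1, 1⟩, ⟨2, 1⟩, ⟨2, 0⟩, 1⟩, ⟨⟨1, 1⟩, ⟨2, 1⟩, ⟨2, 0⟩, ⟨0, -1⟩⟩,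
     ⟨1, ⟨1, -1⟩, ⟨1, -1⟩, ⟨0, -1⟩⟩, ⟨⟨1, 1⟩, ⟨2, 0⟩, ⟨1, -1⟩, ⟨0, -1⟩⟩, ⟨⟨1, 1⟩, ⟨2, 1⟩, 1, 1⟩,
     ⟨⟨0, 1⟩, ⟨1, 2⟩, ⟨2, 1⟩, 1⟩, ⟨1, 1, ⟨1, -1⟩, ⟨0, -1⟩⟩, ⟨1, 1, 1, 1⟩, ⟨0, 1, ⟨1, -1⟩, ⟨0, -1⟩⟩,
     ⟨0, 1, 1, 1⟩, ⟨0, 0, 1, 1⟩, ⟨0, 0, 0, 1⟩, ⟨⟨0, 1⟩, ⟨1, 1⟩, ⟨2, 1⟩, 1⟩, ⟨⟨1, 1⟩, 1, 1, 1⟩,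
     ⟨⟨1, 1⟩, ⟨2, 1⟩, 1, ⟨0, -1⟩⟩, ⟨1, 1, ⟨0, -1⟩, ⟨0, -1⟩⟩, ⟨1, 1, 1, ⟨0, -1⟩⟩, ⟨0, ⟨1, 1⟩, 1, 1⟩,
     ⟨0, 1, 1, ⟨0, -1⟩⟩, ⟨0, 0, 1, ⟨0, -1⟩⟩, ⟨⟨0, 1⟩, ⟨1, 1⟩, 1, 1⟩, ⟨⟨1, 1⟩, 1, 1, ⟨0, -1⟩⟩,
     ⟨1, ⟨1, -1⟩, ⟨0, -1⟩, 0⟩, ⟨⟨0, 1⟩, ⟨0, 1⟩, ⟨1, 1⟩, 1⟩, ⟨1, 1, 1, 0⟩, ⟨0, ⟨0, 1⟩, ⟨1, 1⟩, 1⟩,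
     ⟨0, 1, 1, 0⟩, ⟨0, 0, 1, 0⟩, ⟨⟨-1, 0⟩, ⟨0, 1⟩, ⟨1, 1⟩, 1⟩, ⟨⟨1, 1⟩, 1, 1, 0⟩,
     ⟨1, 1, ⟨0, -1⟩, 0⟩, ⟨0, 1, ⟨0, -1⟩, 0⟩, ⟨⟨0, 1⟩, ⟨1, 1⟩, 1, 0⟩, ⟨1, 1, 0, 0⟩, ⟨0, 1, 0, 0⟩,
     ⟨1, ⟨0, -1⟩, 0, 0⟩, ⟨1, 0, 0, 0⟩]
  units := [⟨1, 0⟩, ⟨-1, 0⟩, ⟨0, 1⟩, ⟨0, -1⟩, ⟨1, 1⟩, ⟨-1, -1⟩]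

theorem dataH4_simpleListed : dataH4.simpleListed = true := by decide +kernel
theorem dataH4_closed : dataH4.closed = true := by decide +kernel
theorem dataH4_transitive : dataH4.transitive = true := by decide +kernel
theorem dataH4_reflectionsListed : dataH4.reflectionsListed = true := by decide +kernel
theorem dataH4_planesNotModular : dataH4.planesNotModular = true := by decide +kernel
theorem dataG32_simpleListed : dataG32.simpleListed = true := by decide +kernel
theorem dataG32_closed : dataG32.closed = true := by decide +kernel
theorem dataG32_transitive : dataG32.transitive = true := by decide +kernel
theorem dataG32_reflectionsListed : dataG32.reflectionsListed = true := by decide +kernel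
theorem dataG32_planesNotModular : dataG32.planesNotModular = true := by decide +kernel

/-! ### H₄ and G₃₂ as complex reflection groups realizing the data. -/

section Realizations

/-- The evaluation of a quadratic algebra over `ℤ` at a complex root of its polynomial. -/
def quadEval {a b : ℤ} (u : ℂ) (h : u * u = a + b * u) : QuadraticAlgebra ℤ a b →+* ℂ :=
  (QuadraticAlgebra.lift ⟨u, by simpa using h⟩ : QuadraticAlgebra ℤ a b →ₐ[ℤ] ℂ).toRingHom

theorem quadEval_apply {a b : ℤ} (u : ℂ) (h : u * u = a + b * u) (x : QuadraticAlgebra ℤ a b) :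
    quadEval u h x = x.re + x.im * u := by
  simp [quadEval, QuadraticAlgebra.lift]

theorem mem_of_any_eqQuad {a b : ℤ} {l : List (Quad (QuadraticAlgebra ℤ a b))}
    {x : Quad (QuadraticAlgebra ℤ a b)} (h : l.any (eqQuad x) = true) : x ∈ l := by
  obtain ⟨y, hy, h⟩ := List.any_eq_true.1 h
  rwa [eqQuad_iff.1 h]

variable {V : Type*} [AddCommGroup V] [Module ℂ V]

/-- The sesquilinear form for which the basis vectors correspond to given linear functionals. -/
def formOfFunctionals (e : Module.Basis (Fin 4) ℂ V) (f : Fin 4 → Module.Dual ℂ V) :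
    V →ₗ⋆[ℂ] Module.Dual ℂ V where
  toFun x := ∑ i, conj (e.repr x i) • f i
  map_add' x y := by simp [add_smul, Finset.sum_add_distrib]
  map_smul' c x := by simp [mul_smul, Finset.smul_sum]

theorem formOfFunctionals_apply (e : Module.Basis (Fin 4) ℂ V) (f : Fin 4 → Module.Dual ℂ V)
    (x y : V) : formOfFunctionals e f x y =
      ∑ i, ∑ j, conj (e.repr x i) * f i (e j) * e.repr y j := by
  conv_lhs => rw [← e.sum_repr y]
  simp only [formOfFunctionals, LinearMap.coe_mk, AddHom.coe_mk, LinearMap.sum_apply, map_sum,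
    map_smul, LinearMap.smul_apply, smul_eq_mul, Finset.mul_sum, mul_assoc]
  rw [Finset.sum_comm]
  refine Finset.sum_congr rfl fun i _ => Finset.sum_congr rfl fun j _ => ?_
  ring

theorem formOfFunctionals_basis (e : Module.Basis (Fin 4) ℂ V) (f : Fin 4 → Module.Dual ℂ V)
    (i : Fin 4) : formOfFunctionals e f (e i) = f i := by
  simp [formOfFunctionals, Finsupp.single_apply, apply_ite (starRingEnd ℂ), ite_smul]

theorem formOfFunctionals_embed {a b : ℤ} {D : ReflectionData a b}
    {toC : QuadraticAlgebra ℤ a b →+* ℂ} (hbar : ∀ r, toC (D.bar r) = conj (toC r))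
    {e : Module.Basis (Fin 4) ℂ V} {f : Fin 4 → Module.Dual ℂ V}
    {C : Fin 4 → Fin 4 → QuadraticAlgebra ℤ a b} (hC : ∀ i j, f i (e j) = toC (C i j))
    (hD : ∀ x y, D.form x y = ∑ i, ∑ j, D.bar (x.coord i) * C i j * y.coord j)
    (x y : Quad (QuadraticAlgebra ℤ a b)) :
    formOfFunctionals e f (∑ i, toC (x.coord i) • e i) (∑ i, toC (y.coord i) • e i) =
      toC (D.form x y) := by
  rw [formOfFunctionals_apply, hD]
  simp only [Module.Basis.repr_sum_self, hC]
  simp only [map_sum, map_mul, hbar]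

theorem formOfFunctionals_symm {a b : ℤ} {D : ReflectionData a b}
    {toC : QuadraticAlgebra ℤ a b →+* ℂ} (hbar : ∀ r, toC (D.bar r) = conj (toC r))
    {e : Module.Basis (Fin 4) ℂ V} {f : Fin 4 → Module.Dual ℂ V}
    {C : Fin 4 → Fin 4 → QuadraticAlgebra ℤ a b} (hC : ∀ i j, f i (e j) = toC (C i j))
    (h : ∀ i j, C j i = D.bar (C i j) * (C i i - 1)) (x : V) (i : Fin 4) :
    formOfFunctionals e f x (e i) = conj (formOfFunctionals e f (e i) x) *
      (formOfFunctionals e f (e i) (e i) - 1) := by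
  rw [formOfFunctionals_basis]
  conv_rhs => rw [← e.sum_repr x]
  simp only [formOfFunctionals, LinearMap.coe_mk, AddHom.coe_mk, LinearMap.sum_apply,
    LinearMap.smul_apply, smul_eq_mul, map_sum, map_smul, map_mul, Finset.sum_mul, hC]
  refine Finset.sum_congr rfl fun j _ => ?_
  rw [h i j, map_mul, hbar, map_sub, map_one]
  ring

theorem formOfFunctionals_eq_zero (e : Module.Basis (Fin 4) ℂ V) (f : Fin 4 → Module.Dual ℂ V)
    (h : ∀ c : Fin 4 → ℂ, (∀ j, ∑ i, c i * f i (e j) = 0) → c = 0) (x : V)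
    (hx : formOfFunctionals e f x = 0) : x = 0 := by
  have h0 : (fun i => conj (e.repr x i)) = 0 := h _ fun j => by
    have := congrArg (fun g => g (e j)) hx
    simpa [formOfFunctionals] using this
  refine e.repr.injective (Finsupp.ext fun i => ?_)
  simpa using congrFun h0 i

/-- The unit vectors. -/
def unitQuad {a b : ℤ} : Fin 4 → Quad (QuadraticAlgebra ℤ a b) :=
  ![⟨1, 0, 0, 0⟩, ⟨0, 1, 0, 0⟩, ⟨0, 0, 1, 0⟩, ⟨0, 0, 0, 1⟩]

/-- A criterion for the line spanned by the first basis vector to be an intersection of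
hyperplanes. -/
theorem line_mem_of_form {a b : ℤ} {D : ReflectionData a b}
    {toC : QuadraticAlgebra ℤ a b →+* ℂ} {e : Module.Basis (Fin 4) ℂ V}
    {F : V → Module.Dual ℂ V} (hF : ∀ x y : Quad (QuadraticAlgebra ℤ a b),
      F (∑ i, toC (x.coord i) • e i) (∑ i, toC (y.coord i) • e i) = toC (D.form x y))
    (r : Fin 3 → Quad (QuadraticAlgebra ℤ a b)) (hr : ∀ k, D.roots.any (eqQuad (r k)) = true)
    (h : ∀ c : Fin 4 → ℂ, (∀ k, ∑ j, c j * toC (D.form (r k) (unitQuad j)) = 0) ↔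
      c 1 = 0 ∧ c 2 = 0 ∧ c 3 = 0) :
    (ℂ ∙ e 0) ∈ intersectionLattice
      {H | ∃ x ∈ D.roots, H = LinearMap.ker (F (∑ i, toC (x.coord i) • e i))} := by
  have hunit : ∀ j, e j = ∑ i, toC ((unitQuad j).coord i) • e i := by
    intro j
    fin_cases j <;> simp [unitQuad, Fin.sum_univ_four]
  have hmem : ∀ x, x ∈ (ℂ ∙ e 0) ↔ ∀ k, x ∈ LinearMap.ker (F (∑ i, toC ((r k).coord i) • e i)) := by
    intro x
    have hx : ∀ k, F (∑ i, toC ((r k).coord i) • e i) x =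
        ∑ j, e.repr x j * toC (D.form (r k) (unitQuad j)) := fun k => by
      conv_lhs => rw [← e.sum_repr x]
      simp only [map_sum, map_smul, smul_eq_mul]
      refine Finset.sum_congr rfl fun j _ => ?_
      rw [← hF, ← hunit]
    simp only [LinearMap.mem_ker, hx]
    rw [h, Submodule.mem_span_singleton]
    constructor
    · rintro ⟨c, rfl⟩
      simp
    · rintro ⟨h1, h2, h3⟩
      refine ⟨e.repr x 0, ?_⟩
      have := e.sum_repr x
      rw [Fin.sum_univ_four, h1, h2, h3] at this
      simpa using this
  refine ⟨Set.range fun k => LinearMap.ker (F (∑ i, toC ((r k).coord i) • e i)), ?_,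
    Set.finite_range _, ?_⟩
  · rintro _ ⟨k, rfl⟩
    exact ⟨r k, mem_of_any_eqQuad (hr k), rfl⟩
  · ext x
    rw [hmem, Submodule.mem_sInf]
    simp

/-- The golden ratio as a complex number. -/
def goldenC : ℂ := (Real.goldenRatio : ℂ)

theorem goldenC_mul_self : goldenC * goldenC = goldenC + 1 := by
  rw [← pow_two, goldenC]
  exact_mod_cast congrArg (fun x : ℝ => (x : ℂ)) Real.goldenRatio_sq

theorem conj_goldenC : conj goldenC = goldenC := Complex.conj_ofReal _

/-- The inclusion of `ℤ[φ]` in `ℂ`. -/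
def goldenEval : GoldenInt →+* ℂ :=
  quadEval goldenC (by rw [goldenC_mul_self]; push_cast; ring)

theorem goldenEval_apply (x : GoldenInt) : goldenEval x = x.re + x.im * goldenC :=
  quadEval_apply _ _ _

theorem goldenEval_mk (m n : ℤ) : goldenEval ⟨m, n⟩ = m + n * goldenC := goldenEval_apply _

theorem goldenEval_injective : Function.Injective goldenEval := by
  rw [injective_iff_map_eq_zero]
  intro x hx
  rw [goldenEval_apply, goldenC] at hx
  have hx : (x.re : ℝ) + x.im * Real.goldenRatio = 0 := Complex.ofReal_injective (by simpa using hx)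
  have him : x.im = 0 := by
    by_contra h
    refine Real.goldenRatio_irrational ⟨-x.re / x.im, ?_⟩
    have h' : (x.im : ℝ) ≠ 0 := by exact_mod_cast h
    push_cast
    rw [div_eq_iff h']
    generalize Real.goldenRatio = φ at hx ⊢
    linear_combination -hx
  rw [him] at hx
  have hre : x.re = 0 := by simpa using hx
  exact QuadraticAlgebra.ext hre him

theorem simpleCoroot_of_eq {B : Type*} [Fintype B] [DecidableEq B] {M : CoxeterMatrix B}
    {i j : B} {n : ℕ} (h : M i j = n) {z : ℂ} (hz : ((-2 * Real.cos (Real.pi / n) : ℝ) : ℂ) = z) :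
    simpleCoroot M i (Pi.single j 1) = z := by
  rw [← hz, ← h]
  simp [simpleCoroot, Pi.single_apply]

theorem neg_two_mul_cos_pi_div_one : ((-2 * Real.cos (Real.pi / (1 : ℕ)) : ℝ) : ℂ) = 2 := by
  simp

theorem neg_two_mul_cos_pi_div_two : ((-2 * Real.cos (Real.pi / (2 : ℕ)) : ℝ) : ℂ) = 0 := by
  simp

theorem neg_two_mul_cos_pi_div_three : ((-2 * Real.cos (Real.pi / (3 : ℕ)) : ℝ) : ℂ) = -1 := by
  rw [Nat.cast_ofNat, Real.cos_pi_div_three]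
  push_cast
  ring

theorem neg_two_mul_cos_pi_div_five :
    ((-2 * Real.cos (Real.pi / (5 : ℕ)) : ℝ) : ℂ) = -goldenC := by
  rw [Nat.cast_ofNat, Real.cos_pi_div_five, goldenC, Real.goldenRatio]
  push_cast
  ring

/-- The Cartan matrix of type `H₄`. -/
def cartanH4 : Fin 4 → Fin 4 → GoldenInt :=
  ![![⟨2, 0⟩, -1, 0, 0], ![-1, ⟨2, 0⟩, -1, 0], ![0, -1, ⟨2, 0⟩, -⟨0, 1⟩], ![0, 0, -⟨0, 1⟩, ⟨2, 0⟩]]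

theorem simpleCoroot_H4 (i j : Fin 4) : simpleCoroot CoxeterMatrix.H₄ i (Pi.single j 1) =
    goldenEval (cartanH4 i j) := by
  fin_cases i <;> fin_cases j
  all_goals first
    | exact simpleCoroot_of_eq (n := 1) (by decide)
        (neg_two_mul_cos_pi_div_one.trans (by simp [goldenEval_mk, cartanH4, -QuadraticAlgebra.neg_mk]))
    | exact simpleCoroot_of_eq (n := 2) (by decide)
        (neg_two_mul_cos_pi_div_two.trans (by simp [cartanH4, -QuadraticAlgebra.neg_mk]))
    | exact simpleCoroot_of_eq (n := 3) (by decide)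
        (neg_two_mul_cos_pi_div_three.trans (by simp [cartanH4, -QuadraticAlgebra.neg_mk]))
    | exact simpleCoroot_of_eq (n := 5) (by decide)
        (neg_two_mul_cos_pi_div_five.trans (by simp [goldenEval_mk, cartanH4, -QuadraticAlgebra.neg_mk]))

theorem goldenEval_bar (r : GoldenInt) : goldenEval (dataH4.bar r) = conj (goldenEval r) := by
  simp [goldenEval_apply, dataH4, conj_goldenC]

theorem form_dataH4 (x y : Quad GoldenInt) :
    dataH4.form x y = ∑ i, ∑ j, dataH4.bar (x.coord i) * cartanH4 i j * y.coord j := by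
  simp [Fin.sum_univ_four, dataH4, cartanH4, -QuadraticAlgebra.neg_mk]
  ring

theorem basisFun_cartanH4 (i j : Fin 4) :
    simpleCoroot CoxeterMatrix.H₄ i (Pi.basisFun ℂ (Fin 4) j) = goldenEval (cartanH4 i j) := by
  rw [Pi.basisFun_apply, simpleCoroot_H4]

theorem formH4_eq_zero (x : Fin 4 → ℂ) (hx : formOfFunctionals (Pi.basisFun ℂ (Fin 4))
    (simpleCoroot CoxeterMatrix.H₄) x = 0) : x = 0 := by
  refine formOfFunctionals_eq_zero _ _ (fun c hc => ?_) x hx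
  have h0 := hc 0
  have h1 := hc 1
  have h2 := hc 2
  have h3 := hc 3
  have hφ := goldenC_mul_self
  simp [basisFun_cartanH4, -Pi.basisFun_apply, Fin.sum_univ_four, goldenEval_mk, cartanH4,
    -QuadraticAlgebra.neg_mk] at h0 h1 h2 h3
  have hc0 : c 0 = 0 := by grind
  have hc1 : c 1 = 0 := by grind
  have hc2 : c 2 = 0 := by grind
  have hc3 : c 3 = 0 := by grind
  ext i
  fin_cases i <;> assumption

/-- The line of a simple root is cut out by three hyperplanes. -/
theorem line_mem_H4 : (ℂ ∙ Pi.basisFun ℂ (Fin 4) 0) ∈ intersectionLattice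
    {H | ∃ x ∈ dataH4.roots, H = LinearMap.ker (formOfFunctionals (Pi.basisFun ℂ (Fin 4))
      (simpleCoroot CoxeterMatrix.H₄)
      (∑ i, goldenEval (x.coord i) • Pi.basisFun ℂ (Fin 4) i))} := by
  refine line_mem_of_form (formOfFunctionals_embed goldenEval_bar basisFun_cartanH4 form_dataH4)
    -- Three roots orthogonal to the first simple root. Their equations read `c₁ = c₃`, `c₂ = c₃`
    -- and `φ c₁ = c₂`, and `φ ≠ 1`.
    ![⟨⟨0, 1⟩, ⟨0, 2⟩, ⟨1, 3⟩, ⟨2, 2⟩⟩, ⟨⟨1, 1⟩, ⟨2, 2⟩, ⟨3, 3⟩, ⟨1, 3⟩⟩,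
      ⟨⟨0, 1⟩, ⟨0, 2⟩, ⟨0, 2⟩, ⟨1, 1⟩⟩] (by decide +kernel) fun c => ?_
  have hrow : ∀ k j, dataH4.form (![⟨⟨0, 1⟩, ⟨0, 2⟩, ⟨1, 3⟩, ⟨2, 2⟩⟩,
      ⟨⟨1, 1⟩, ⟨2, 2⟩, ⟨3, 3⟩, ⟨1, 3⟩⟩, ⟨⟨0, 1⟩, ⟨0, 2⟩, ⟨0, 2⟩, ⟨1, 1⟩⟩] k) (unitQuad j) =
      (![![0, -1, 0, 1], ![0, 0, 1, -1], ![0, ⟨0, 1⟩, -1, 0]] : Fin 3 → Fin 4 → GoldenInt) k j := by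
    decide +kernel
  simp only [hrow, Fin.forall_fin_succ, Fin.sum_univ_four]
  have hφ := goldenC_mul_self
  simp [goldenEval_mk]
  grind

/-- The reflection group of type `H₄` as a realization of the data. -/
def realizationH4 : dataH4.Realization (Fin 4 → ℂ) where
  toC := goldenEval
  toC_injective := goldenEval_injective
  toC_bar := goldenEval_bar
  basis := Pi.basisFun ℂ (Fin 4)
  form := formOfFunctionals (Pi.basisFun ℂ (Fin 4)) (simpleCoroot CoxeterMatrix.H₄)
  form_embed := formOfFunctionals_embed goldenEval_bar basisFun_cartanH4 form_dataH4
  eq_zero_of_form := formH4_eq_zero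
  refl := simpleReflection CoxeterMatrix.H₄
  refl_apply i x := by
    rw [formOfFunctionals_basis, simpleReflection, Module.reflection_apply, Pi.basisFun_apply]
  form_apply_basis := formOfFunctionals_symm goldenEval_bar basisFun_cartanH4 (by decide +kernel)
  getLast := rfl
  units_mul := by decide +kernel
  units_ne_zero := by decide +kernel
  simpleListed := dataH4_simpleListed
  closed := dataH4_closed
  transitive := dataH4_transitive
  reflectionsListed := dataH4_reflectionsListed
  planesNotModular := dataH4_planesNotModular
  line_mem := line_mem_H4

/-- A primitive cube root of unity. -/
def eisensteinC : ℂ := Complex.exp (2 * Real.pi * Complex.I / 3)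

theorem eisensteinC_mul_self : eisensteinC * eisensteinC = -1 - eisensteinC := by
  have h := (Complex.isPrimitiveRoot_exp 3 (by norm_num)).geom_sum_eq_zero (by norm_num)
  rw [Finset.sum_range_succ, Finset.sum_range_succ, Finset.sum_range_one, pow_zero, pow_one,
    pow_two] at h
  have h' : (1 : ℂ) + eisensteinC + eisensteinC * eisensteinC = 0 := by
    simpa [eisensteinC] using h
  linear_combination h'

theorem conj_eisensteinC : conj eisensteinC = -1 - eisensteinC := by
  have h1 : eisensteinC * conj eisensteinC = 1 := by
    rw [eisensteinC, ← Complex.exp_conj, ← Complex.exp_add, ← Complex.exp_zero]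
    congr 1
    simp [map_ofNat]
    ring
  have h2 : eisensteinC * (-1 - eisensteinC) = 1 := by
    linear_combination -eisensteinC_mul_self
  exact mul_left_cancel₀ (left_ne_zero_of_mul_eq_one h1) (h1.trans h2.symm)

/-- The inclusion of `ℤ[ω]` in `ℂ`. -/
def eisensteinEval : EisensteinInt →+* ℂ :=
  quadEval eisensteinC (by rw [eisensteinC_mul_self]; push_cast; ring)

theorem eisensteinEval_apply (x : EisensteinInt) :
    eisensteinEval x = x.re + x.im * eisensteinC := quadEval_apply _ _ _

theorem eisensteinEval_mk (m n : ℤ) : eisensteinEval ⟨m, n⟩ = m + n * eisensteinC :=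
  eisensteinEval_apply _

theorem eisensteinEval_injective : Function.Injective eisensteinEval := by
  rw [injective_iff_map_eq_zero]
  intro x hx
  rw [eisensteinEval_apply] at hx
  have him : x.im = 0 := by
    by_contra h
    have h' : (x.im : ℂ) ≠ 0 := by exact_mod_cast h
    have hc := congrArg conj hx
    simp only [map_add, map_mul, map_intCast, map_zero, conj_eisensteinC] at hc
    -- Here `2ω + 1` is the difference of `ω` and its conjugate; its square is `-3`.
    have h2 : (x.im : ℂ) * (2 * eisensteinC + 1) = 0 := by linear_combination hx - hc
    have h3 := (mul_eq_zero.1 h2).resolve_left h'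
    have h4 : (3 : ℂ) = 0 := by
      linear_combination 4 * eisensteinC_mul_self - (2 * eisensteinC + 1) * h3
    norm_num at h4
  rw [him] at hx
  have hre : x.re = 0 := by simpa using hx
  exact QuadraticAlgebra.ext hre him

theorem eisensteinEval_bar (r : EisensteinInt) :
    eisensteinEval (dataG32.bar r) = conj (eisensteinEval r) := by
  simp only [dataG32, eisensteinConj, eisensteinEval_apply, map_add, map_mul, map_intCast,
    conj_eisensteinC]
  push_cast
  ring

/-- The Cartan matrix of `G₃₂`. -/
def cartanG32 : Fin 4 → Fin 4 → EisensteinInt :=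
  ![![⟨1, -1⟩, -1, 0, 0], ![⟨0, 1⟩, ⟨1, -1⟩, -1, 0], ![0, ⟨0, 1⟩, ⟨1, -1⟩, -1],
    ![0, 0, ⟨0, 1⟩, ⟨1, -1⟩]]

/-- The factors by which the basis vectors differ from the given roots. -/
def scaleG32 : Fin 4 → ℂ := ![eisensteinC - 1, 1, -eisensteinC - 2, 1 + eisensteinC]

/-- The inverses of the factors by which the basis vectors differ from the given roots. -/
def invScaleG32 : Fin 4 → ℂ := ![(-eisensteinC - 2) / 3, 1, (eisensteinC - 1) / 3, -eisensteinC]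

theorem invScaleG32_mul (i : Fin 4) : invScaleG32 i * scaleG32 i = 1 := by
  have h := eisensteinC_mul_self
  fin_cases i <;> simp [scaleG32, invScaleG32] <;> grind

theorem linearIndependent_g32 : LinearIndependent ℂ fun i => scaleG32 i • g32Root i := by
  rw [Fintype.linearIndependent_iff]
  intro c hc
  have hs : ∀ i, scaleG32 i ≠ 0 := fun i => right_ne_zero_of_mul_eq_one (invScaleG32_mul i)
  have h0 := congrFun hc 0
  have h1 := congrFun hc 1
  have h2 := congrFun hc 2
  have h3 := congrFun hc 3
  simp [Fin.sum_univ_four, g32Root, hs] at h0 h1 h2 h3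
  simp [h3, hs] at h2
  simp [h2, h3, hs] at h0 h1
  intro i
  fin_cases i <;> assumption

/-- A basis of roots of `G₃₂`. -/
def basisG32 : Module.Basis (Fin 4) ℂ (Fin 4 → ℂ) :=
  basisOfLinearIndependentOfCardEqFinrank linearIndependent_g32 (by simp)

theorem basisG32_apply (i : Fin 4) : basisG32 i = scaleG32 i • g32Root i := by
  simp [basisG32]

/-- The linear functionals that belong to the basis of roots of `G₃₂`. -/
def functionalG32 (i : Fin 4) : Module.Dual ℂ (Fin 4 → ℂ) :=
  invScaleG32 i • rootForm eisensteinC (g32Root i)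

/-- The given roots have Hermitian norms 1, 3, 1, 3. The scaling factors make all four norms equal
to 3 and adjust the phases so that neighbouring entries are `-1` above the diagonal and `ω` below
it. The inverse factor in the functional leaves each reflection unchanged. -/
theorem functionalG32_basisG32 (i j : Fin 4) :
    functionalG32 i (basisG32 j) = eisensteinEval (cartanG32 i j) := by
  have h := eisensteinC_mul_self
  rw [basisG32_apply]
  fin_cases i <;> fin_cases j <;>
    simp [functionalG32, rootForm, g32Root, Fin.sum_univ_four, dotProduct, scaleG32, invScaleG32,
      eisensteinEval_mk, cartanG32] <;> grind

theorem form_dataG32 (x y : Quad EisensteinInt) :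
    dataG32.form x y = ∑ i, ∑ j, dataG32.bar (x.coord i) * cartanG32 i j * y.coord j := by
  simp [Fin.sum_univ_four, dataG32, cartanG32]
  ring

theorem formG32_eq_zero (x : Fin 4 → ℂ)
    (hx : formOfFunctionals basisG32 functionalG32 x = 0) : x = 0 := by
  refine formOfFunctionals_eq_zero _ _ (fun c hc => ?_) x hx
  have h0 := hc 0
  have h1 := hc 1
  have h2 := hc 2
  have h3 := hc 3
  have hω := eisensteinC_mul_self
  simp [functionalG32_basisG32, Fin.sum_univ_four, eisensteinEval_mk, cartanG32] at h0 h1 h2 h3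
  have hc3 : c 3 = 0 := by grind
  have hc2 : c 2 = 0 := by grind
  have hc1 : c 1 = 0 := by grind
  have hc0 : c 0 = 0 := by grind
  ext i
  fin_cases i <;> assumption

/-- The line of a simple root is cut out by three hyperplanes. -/
theorem line_mem_G32 : (ℂ ∙ basisG32 0) ∈ intersectionLattice
    {H | ∃ x ∈ dataG32.roots, H = LinearMap.ker (formOfFunctionals basisG32 functionalG32
      (∑ i, eisensteinEval (x.coord i) • basisG32 i))} := by
  refine line_mem_of_form
    (formOfFunctionals_embed eisensteinEval_bar functionalG32_basisG32 form_dataG32)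
    -- Three roots orthogonal to the first basis root, chosen so that the equations for the other
    -- three coordinates are triangular.
    ![⟨⟨1, 1⟩, ⟨2, 1⟩, ⟨2, 0⟩, ⟨1, -1⟩⟩, ⟨⟨1, 1⟩, ⟨2, 1⟩, ⟨2, 0⟩, 1⟩, ⟨0, 0, 1, 0⟩]
    (by decide +kernel) fun c => ?_
  have hrow : ∀ k j, dataG32.form (![⟨⟨1, 1⟩, ⟨2, 1⟩, ⟨2, 0⟩, ⟨1, -1⟩⟩,
      ⟨⟨1, 1⟩, ⟨2, 1⟩, ⟨2, 0⟩, 1⟩, ⟨0, 0, 1, 0⟩] k) (unitQuad j) =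
      (![![0, 0, 0, 1], ![0, 0, 1, ⟨-1, -1⟩], ![0, ⟨0, 1⟩, ⟨1, -1⟩, -1]] :
        Fin 3 → Fin 4 → EisensteinInt) k j := by
    decide +kernel
  simp only [hrow, Fin.forall_fin_succ, Fin.sum_univ_four]
  have hω := eisensteinC_mul_self
  simp [eisensteinEval_mk]
  grind

/-- The group `G₃₂` as a realization of the data. -/
def realizationG32 : dataG32.Realization (Fin 4 → ℂ) where
  toC := eisensteinEval
  toC_injective := eisensteinEval_injective
  toC_bar := eisensteinEval_bar
  basis := basisG32
  form := formOfFunctionals basisG32 functionalG32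
  form_embed := formOfFunctionals_embed eisensteinEval_bar functionalG32_basisG32 form_dataG32
  eq_zero_of_form := formG32_eq_zero
  refl := g32Reflection
  refl_apply i x := by
    rw [formOfFunctionals_basis, basisG32_apply, functionalG32, LinearMap.smul_apply, smul_smul,
      smul_eq_mul, mul_right_comm, invScaleG32_mul, one_mul]
    rfl
  form_apply_basis := formOfFunctionals_symm eisensteinEval_bar functionalG32_basisG32
    (by decide +kernel)
  getLast := rfl
  units_mul := by decide +kernel
  units_ne_zero := by decide +kernel
  simpleListed := dataG32_simpleListed
  closed := dataG32_closed
  transitive := dataG32_transitive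
  reflectionsListed := dataG32_reflectionsListed
  planesNotModular := dataG32_planesNotModular
  line_mem := line_mem_G32

end Realizations

/-! ### Root systems of simply laced diagrams with a branch node. -/

/-- The symmetric matrix `gram` of a positive definite, connected, simply laced diagram with a
branch node. -/
structure SimplyLaced (B : Type*) [Fintype B] [DecidableEq B] where
  /-- Twice the canonical bilinear form. -/
  gram : Matrix B B ℤ
  gram_comm : ∀ i j, gram i j = gram j i
  gram_self : ∀ i, gram i i = 2
  gram_of_ne : ∀ i j, i ≠ j → gram i j = 0 ∨ gram i j = -1
  pos : ∀ x : B → ℤ, x ≠ 0 → 0 < Matrix.toLinearMap₂' ℤ gram x x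
  /-- The branch node. -/
  center : B
  /-- Three neighbours of the branch node. -/
  branch : Fin 3 → B
  branch_injective : Function.Injective branch
  gram_center_branch : ∀ k, gram center (branch k) = -1
  gram_branch_branch : ∀ k l, k ≠ l → gram (branch k) (branch l) = 0
  connected : ∀ i, Relation.ReflTransGen (fun i j => gram i j = -1) center i

namespace SimplyLaced

variable {B : Type*} [Fintype B] [DecidableEq B] (D : SimplyLaced B)

/-- The bilinear form of the root lattice. -/
def pair : (B → ℤ) →ₗ[ℤ] (B → ℤ) →ₗ[ℤ] ℤ := Matrix.toLinearMap₂' ℤ D.gram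

theorem pair_single (i j : B) : D.pair (Pi.single i 1) (Pi.single j 1) = D.gram i j := by
  simp [pair, Matrix.toLinearMap₂'_apply']

theorem sum_smul_single (x : B → ℤ) : ∑ i, x i • (Pi.single i 1 : B → ℤ) = x := by
  ext j
  simp [Pi.single_apply]

theorem pair_eq_sum (x y : B → ℤ) : D.pair x y = ∑ i, x i * D.pair (Pi.single i 1) y := by
  conv_lhs => rw [← sum_smul_single x]
  simp only [map_sum, LinearMap.sum_apply, map_smul, LinearMap.smul_apply, smul_eq_mul]

theorem pair_apply (x y : B → ℤ) : D.pair x y = ∑ i, ∑ j, x i * D.gram i j * y j := by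
  rw [pair_eq_sum]
  refine Finset.sum_congr rfl fun i _ => ?_
  conv_lhs => rw [← sum_smul_single y]
  simp only [map_sum, map_smul, smul_eq_mul, pair_single, Finset.mul_sum]
  exact Finset.sum_congr rfl fun j _ => by ring

theorem pair_comm (x y : B → ℤ) : D.pair x y = D.pair y x := by
  rw [pair_apply, pair_apply, Finset.sum_comm]
  refine Finset.sum_congr rfl fun i _ => Finset.sum_congr rfl fun j _ => ?_
  rw [D.gram_comm]
  ring

theorem pair_pos {x : B → ℤ} (hx : x ≠ 0) : 0 < D.pair x x := D.pos x hx

theorem even_pair_self (x : B → ℤ) : Even (D.pair x x) := by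
  rw [← sum_smul_single x]
  refine Finset.sum_induction _ (fun x => Even (D.pair x x)) (fun x y hx hy => ?_) (by simp)
    fun i _ => ?_
  · have : D.pair (x + y) (x + y) = D.pair x x + D.pair y y + 2 * D.pair x y := by
      simp only [map_add, LinearMap.add_apply]
      rw [D.pair_comm y x]
      ring
    rw [this]
    exact (hx.add hy).add (even_two_mul _)
  · simp only [map_smul, LinearMap.smul_apply, smul_eq_mul, pair_single, D.gram_self]
    exact ((even_two.mul_left _).mul_left _)

theorem two_le_pair_self {x : B → ℤ} (hx : x ≠ 0) : 2 ≤ D.pair x x := by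
  have := D.pair_pos hx
  obtain ⟨k, hk⟩ := D.even_pair_self x
  omega

/-- The roots: the vectors of square length `2` of the root lattice. -/
def IsRoot (x : B → ℤ) : Prop := D.pair x x = 2

variable {D}

theorem IsRoot.ne_zero {x : B → ℤ} (hx : D.IsRoot x) : x ≠ 0 := by
  rintro rfl
  simp [IsRoot] at hx

theorem IsRoot.neg {x : B → ℤ} (hx : D.IsRoot x) : D.IsRoot (-x) := by
  simpa [IsRoot] using hx

theorem IsRoot.add {x y : B → ℤ} (hx : D.IsRoot x) (hy : D.IsRoot y) (h : D.pair x y = -1) :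
    D.IsRoot (x + y) := by
  unfold IsRoot at *
  simp only [map_add, LinearMap.add_apply]
  rw [D.pair_comm y x]
  linarith

/-- The norm of `x - y` is `4 - 2 (x, y) ≤ 0`. -/
theorem IsRoot.eq_of_two_le {x y : B → ℤ} (hx : D.IsRoot x) (hy : D.IsRoot y)
    (h : 2 ≤ D.pair x y) : x = y := by
  by_contra hne
  have := D.pair_pos (sub_ne_zero.2 hne)
  unfold IsRoot at *
  simp only [map_sub, LinearMap.sub_apply] at this
  rw [D.pair_comm y x] at this
  linarith

theorem IsRoot.eq_neg_of_le {x y : B → ℤ} (hx : D.IsRoot x) (hy : D.IsRoot y)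
    (h : D.pair x y ≤ -2) : x = -y :=
  hx.eq_of_two_le hy.neg (by rw [map_neg]; linarith)

variable (D)

theorem isRoot_single (i : B) : D.IsRoot (Pi.single i 1) := by
  rw [IsRoot, pair_single, D.gram_self]

/-- The simple reflections of the root lattice. -/
def simpleRefl (i : B) (x : B → ℤ) : B → ℤ :=
  x - D.pair (Pi.single i 1) x • Pi.single i 1

theorem pair_simpleRefl (i : B) (x y : B → ℤ) :
    D.pair (D.simpleRefl i x) (D.simpleRefl i y) = D.pair x y := by
  simp only [simpleRefl, map_sub, map_smul, LinearMap.sub_apply, LinearMap.smul_apply, smul_eq_mul,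
    pair_single, D.gram_self]
  rw [D.pair_comm x (Pi.single i 1)]
  ring

theorem simpleRefl_simpleRefl (i : B) (x : B → ℤ) :
    D.simpleRefl i (D.simpleRefl i x) = x := by
  simp only [simpleRefl, map_sub, map_smul, smul_eq_mul, pair_single, D.gram_self]
  module

theorem simpleRefl_neg (i : B) (x : B → ℤ) : D.simpleRefl i (-x) = -D.simpleRefl i x := by
  simp only [simpleRefl, map_neg]
  module

theorem simpleRefl_single_self (i : B) :
    D.simpleRefl i (Pi.single i 1) = -Pi.single i 1 := by
  simp only [simpleRefl, pair_single, D.gram_self]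
  module

variable {D}

theorem IsRoot.simpleRefl {x : B → ℤ} (hx : D.IsRoot x) (i : B) : D.IsRoot (D.simpleRefl i x) := by
  rw [IsRoot, pair_simpleRefl, hx]

theorem pair_simpleRefl_left (i : B) (x y : B → ℤ) :
    D.pair (D.simpleRefl i x) y = D.pair x (D.simpleRefl i y) := by
  rw [← D.pair_simpleRefl i, simpleRefl_simpleRefl]

/-- The coordinates of a root have the same sign. -/
theorem IsRoot.nonneg_or_nonpos {x : B → ℤ} (hx : D.IsRoot x) : 0 ≤ x ∨ x ≤ 0 := by
  by_contra! h
  have h1 : x⁺ ≠ 0 := fun h' => h.2 (posPart_eq_zero.1 h')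
  have h2 : x⁻ ≠ 0 := fun h' => h.1 (negPart_eq_zero.1 h')
  have h3 := D.two_le_pair_self h1
  have h4 := D.two_le_pair_self h2
  -- The two parts have disjoint supports and the off-diagonal entries are nonpositive. If both
  -- parts were nonzero, the norm of `x` would be at least `2 + 2`, the lattice being even.
  have h5 : D.pair x⁺ x⁻ ≤ 0 := by
    rw [pair_apply]
    refine Finset.sum_nonpos fun i _ => Finset.sum_nonpos fun j _ => ?_
    have hi : 0 ≤ x⁺ i := posPart_nonneg x i
    have hj : 0 ≤ x⁻ j := negPart_nonneg x j
    by_cases hij : i = j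
    · subst hij
      have : x⁺ i = 0 ∨ x⁻ i = 0 := by
        rw [Pi.posPart_apply, Pi.negPart_apply]
        rcases le_total (x i) 0 with h | h
        · exact Or.inl (posPart_eq_zero.2 h)
        · exact Or.inr (negPart_eq_zero.2 h)
      rcases this with h | h <;> simp [h]
    · rcases D.gram_of_ne i j hij with h | h
      · simp [h]
      · rw [h]
        nlinarith [mul_nonneg hi hj]
  unfold IsRoot at hx
  rw [← posPart_sub_negPart x] at hx
  simp only [map_sub, LinearMap.sub_apply] at hx
  rw [D.pair_comm x⁻ x⁺] at hx
  linarith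

/-- All roots are obtained from one simple root by simple reflections. -/
theorem IsRoot.induction {p : (B → ℤ) → Prop} (center : p (Pi.single D.center 1))
    (step : ∀ i x, D.IsRoot x → p x → p (D.simpleRefl i x)) {x : B → ℤ} (hx : D.IsRoot x) :
    p x := by
  have simple : ∀ i, p (Pi.single i 1) := by
    intro i
    induction D.connected i with
    | refl => exact center
    | @tail j k _ hjk ih =>
      -- For adjacent nodes, `s_j s_k e_j = s_j (e_j + e_k) = e_k`.
      have h1 := step j _ ((D.isRoot_single j).simpleRefl k) (step k _ (D.isRoot_single j) ih)
      convert h1 using 1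
      have hkj : D.gram k j = -1 := by rw [D.gram_comm, hjk]
      simp only [SimplyLaced.simpleRefl, map_sub, map_smul, smul_eq_mul, pair_single, hkj, hjk,
        D.gram_self]
      module
  -- Induction on the height: a positive root has a positive product with some simple root in its
  -- support, and is either that simple root or has its height lowered by one under the reflection.
  -- Negatives are carried along; they start from `s_i e_i = -e_i`.
  have positive : ∀ n : ℕ, ∀ x, D.IsRoot x → 0 ≤ x → ∑ i, x i = n → p x ∧ p (-x) := by
    intro n
    induction n with
    | zero =>
      intro x hx h0 hs
      refine absurd (funext fun i => ?_) hx.ne_zero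
      exact (Finset.sum_eq_zero_iff_of_nonneg fun i _ => h0 i).1 hs i (Finset.mem_univ i)
    | succ n ih =>
      intro x hx h0 hs
      have hsum := D.pair_eq_sum x x
      obtain ⟨i, hi⟩ : ∃ i, 0 < x i * D.pair (Pi.single i 1) x := by
        by_contra! h
        have := Finset.sum_nonpos fun i (_ : i ∈ Finset.univ) => h i
        unfold IsRoot at hx
        linarith
      have hxi : 0 < x i := lt_of_le_of_ne (h0 i) fun h => by simp [← h] at hi
      have hpi : 0 < D.pair (Pi.single i 1) x := by
        exact (pos_iff_pos_of_mul_pos hi).1 hxi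
      by_cases h2 : 2 ≤ D.pair (Pi.single i 1) x
      · rw [← (D.isRoot_single i).eq_of_two_le hx h2]
        refine ⟨simple i, ?_⟩
        rw [← D.simpleRefl_single_self]
        exact step i _ (D.isRoot_single i) (simple i)
      · have h1 : D.pair (Pi.single i 1) x = 1 := by omega
        have hs' : D.simpleRefl i x = x - Pi.single i 1 := by
          rw [SimplyLaced.simpleRefl, h1, one_smul]
        obtain ⟨ha, hb⟩ := ih (D.simpleRefl i x) (hx.simpleRefl i) (by
          rw [hs']
          intro j
          have := h0 j
          by_cases hij : j = i
          · subst hij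
            simp
            omega
          · simpa [hij] using this) (by
          rw [hs']
          simp [hs])
        have ha' := step i _ (hx.simpleRefl i) ha
        have hb' := step i _ (hx.simpleRefl i).neg hb
        rw [simpleRefl_simpleRefl] at ha'
        rw [simpleRefl_neg, simpleRefl_simpleRefl] at hb'
        exact ⟨ha', hb'⟩
  rcases hx.nonneg_or_nonpos with h | h
  · exact (positive (∑ i, x i).toNat x hx h
      (Int.toNat_of_nonneg (Finset.sum_nonneg fun i _ => h i)).symm).1
  · have h' : 0 ≤ -x := neg_nonneg.2 h
    have := (positive (∑ i, (-x) i).toNat (-x) hx.neg h'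
      (Int.toNat_of_nonneg (Finset.sum_nonneg fun i _ => h' i)).symm).2
    rwa [neg_neg] at this

theorem IsRoot.pair_cases {x y : B → ℤ} (hx : D.IsRoot x) (hy : D.IsRoot y) (h1 : x ≠ y)
    (h2 : x ≠ -y) : D.pair x y = -1 ∨ D.pair x y = 0 ∨ D.pair x y = 1 := by
  have h3 : ¬ 2 ≤ D.pair x y := fun h => h1 (hx.eq_of_two_le hy h)
  have h4 : ¬ D.pair x y ≤ -2 := fun h => h2 (hx.eq_neg_of_le hy h)
  omega

/-- One of `z`, `s_i z`, `e_i` works: if `z` fails and `e_i ⊥ x`, then `s_i z` has the same product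
with `x` as `z`, and the same product with `s_i y` as `z` with `y`. If `e_i` is orthogonal to `s_i
y`, then `s_i y = y`. -/
theorem exists_pair_ne_zero_simpleRefl {x y : B → ℤ} (i : B)
    (h : ∃ z, D.IsRoot z ∧ D.pair z x ≠ 0 ∧ D.pair z y ≠ 0) :
    ∃ z, D.IsRoot z ∧ D.pair z x ≠ 0 ∧ D.pair z (D.simpleRefl i y) ≠ 0 := by
  obtain ⟨z, hz, hzx, hzy⟩ := h
  by_cases h0 : D.pair z (D.simpleRefl i y) = 0
  · by_cases hx : D.pair (Pi.single i 1) x = 0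
    · refine ⟨D.simpleRefl i z, hz.simpleRefl i, ?_, by rwa [pair_simpleRefl]⟩
      rwa [pair_simpleRefl_left, SimplyLaced.simpleRefl, hx, zero_smul, sub_zero]
    · refine ⟨Pi.single i 1, D.isRoot_single i, hx, fun hy => ?_⟩
      rw [← pair_simpleRefl_left, simpleRefl_single_self, map_neg, LinearMap.neg_apply,
        neg_eq_zero] at hy
      rw [SimplyLaced.simpleRefl, hy, zero_smul, sub_zero] at h0
      exact hzy h0
  · exact ⟨z, hz, hzx, h0⟩

theorem exists_pair_ne_zero {x y : B → ℤ} (hx : D.IsRoot x) (hy : D.IsRoot y) :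
    ∃ z, D.IsRoot z ∧ D.pair z x ≠ 0 ∧ D.pair z y ≠ 0 := by
  refine hy.induction (p := fun y => ∃ z, D.IsRoot z ∧ D.pair z x ≠ 0 ∧ D.pair z y ≠ 0) ?_
    fun i y _ h => exists_pair_ne_zero_simpleRefl i h
  refine hx.induction (p := fun x => ∃ z, D.IsRoot z ∧ D.pair z x ≠ 0 ∧
    D.pair z (Pi.single D.center 1) ≠ 0) ?_ fun i x _ h => ?_
  · exact ⟨_, D.isRoot_single D.center, by simp [pair_single, D.gram_self],
      by simp [pair_single, D.gram_self]⟩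
  · simp only [and_comm (a := D.pair _ (D.simpleRefl i x) ≠ 0)]
    simp only [and_comm (a := D.pair _ x ≠ 0)] at h
    exact exists_pair_ne_zero_simpleRefl i h

/-- Start from a root not orthogonal to either and correct signs: replace `z` by `-z` to get `(z, x)
= 1`, and by `z + y` if `(z, y) = -1`, which does not affect the product with `x`. -/
theorem exists_pair_eq_one {x y : B → ℤ} (hx : D.IsRoot x) (hy : D.IsRoot y)
    (hxy : D.pair x y = 0) : ∃ z, D.IsRoot z ∧ D.pair z x = 1 ∧ D.pair z y = 1 := by
  obtain ⟨z, hz, hzx, hzy⟩ := exists_pair_ne_zero hx hy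
  have hyx : D.pair y x = 0 := by rw [pair_comm, hxy]
  wlog h1 : D.pair z x = 1 generalizing z
  · refine this (-z) hz.neg (by simpa using hzx) (by simpa using hzy) ?_
    have := hz.pair_cases hx (by rintro rfl; exact hzy hxy) (by
      rintro rfl
      simp [hxy] at hzy)
    simp
    omega
  have := hz.pair_cases hy (by rintro rfl; exact hzx hyx) (by
    rintro rfl
    simp [hyx] at hzx)
  rcases this with h | h | h
  · refine ⟨z + y, hz.add hy h, ?_, ?_⟩
    · simp [h1, hyx]
    · unfold IsRoot at hy
      simp [h, hy]
  · exact absurd h hzy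
  · exact ⟨z, hz, h1, h⟩

/-- There are two more roots that form a diagram of type `D₄` with the roots `x` and `y`, with
center `x`. -/
def HasBranches (D : SimplyLaced B) (x y : B → ℤ) : Prop :=
  ∃ z t, D.IsRoot z ∧ D.IsRoot t ∧ D.pair z x = -1 ∧ D.pair t x = -1 ∧ D.pair z y = 0 ∧
    D.pair t y = 0 ∧ D.pair z t = 0

theorem HasBranches.simpleRefl {x y : B → ℤ} (i : B) (h : D.HasBranches x (D.simpleRefl i y)) :
    D.HasBranches (D.simpleRefl i x) y := by
  obtain ⟨z, t, hz, ht, h⟩ := h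
  refine ⟨D.simpleRefl i z, D.simpleRefl i t, hz.simpleRefl i, ht.simpleRefl i, ?_⟩
  rw [pair_simpleRefl, pair_simpleRefl, pair_simpleRefl, pair_simpleRefl_left,
    pair_simpleRefl_left]
  exact h

/-! ### Three orthogonal neighbours of `c` yield a `D₄` with center `c` and any prescribed leaf `y`.
-/

section Branches

variable {c y u v w : B → ℤ} (hc : D.IsRoot c) (hy : D.IsRoot y) (hu : D.IsRoot u)
  (hv : D.IsRoot v) (hw : D.IsRoot w) (hcy : D.pair c y = -1) (huc : D.pair u c = -1)
  (hvc : D.pair v c = -1) (hwc : D.pair w c = -1) (huv : D.pair u v = 0) (huw : D.pair u w = 0)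
  (hvw : D.pair v w = 0)

include hu hv huc hvc huv in
theorem hasBranches_of_eq_zero (huy : D.pair u y = 0) (hvy : D.pair v y = 0) :
    D.HasBranches c y :=
  ⟨u, v, hu, hv, huc, hvc, huy, hvy, huv⟩

include hu hy hv hw hvc hwc huv huw hvw in
theorem hasBranches_of_two_le (huy : 2 ≤ D.pair u y) : D.HasBranches c y := by
  rw [← hu.eq_of_two_le hy huy]
  exact ⟨v, w, hv, hw, hvc, hwc, by rw [pair_comm, huv], by rw [pair_comm, huw], hvw⟩

-- Here `u + y` is a root having product `-2` with `c`, so `c = -(u + y)`: the roots `c`, `u`, `y`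
-- span an `A₂`. The new leaves are the negatives of the images of `v` and `w` under the reflection
-- in `c`.
include hc hu hy hv hw hcy huc hvc hwc huv huw hvw in
theorem hasBranches_of_eq_neg_one (huy : D.pair u y = -1) : D.HasBranches c y := by
  have hcu : D.pair c u = -1 := by rw [pair_comm, huc]
  have hcv : D.pair c v = -1 := by rw [pair_comm, hvc]
  have hcw : D.pair c w = -1 := by rw [pair_comm, hwc]
  have hvu : D.pair v u = 0 := by rw [pair_comm, huv]
  have hwu : D.pair w u = 0 := by rw [pair_comm, huw]
  have h : c = -(u + y) := hc.eq_neg_of_le (hu.add hy huy) (by simp [hcu, hcy])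
  have hy' : y = -c - u := by
    rw [h]
    abel
  have hcc : D.pair c c = 2 := hc
  refine ⟨-(v + c), -(w + c), (hv.add hc hvc).neg, (hw.add hc hwc).neg, ?_⟩
  simp [hy', hcu, hcw, hvu, hwu, hvc, hwc, hvw, hcc]

-- When `u` and `v` both have product 1 with `y`, the root `u + v - y` is orthogonal to `y` and has
-- product `-1` with `c`. Its partner is `w` or, if `w` is not orthogonal to `y`, `u + w - y`.
include hy hu hv hw hcy huc hvc hwc huv huw hvw in
theorem hasBranches_of_eq_one (huy : D.pair u y = 1) (hvy : D.pair v y = 1)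
    (hwy : D.pair w y = 0 ∨ D.pair w y = 1) : D.HasBranches c y := by
  have hyc : D.pair y c = -1 := by rw [pair_comm, hcy]
  have hyu : D.pair y u = 1 := by rw [pair_comm, huy]
  have hyv : D.pair y v = 1 := by rw [pair_comm, hvy]
  have hvu : D.pair v u = 0 := by rw [pair_comm, huv]
  have hwu : D.pair w u = 0 := by rw [pair_comm, huw]
  have hyy : D.pair y y = 2 := hy
  have huu : D.pair u u = 2 := hu
  have hvv : D.pair v v = 2 := hv
  have hww : D.pair w w = 2 := hw
  rcases hwy with hwy | hwy
  · have hyw : D.pair y w = 0 := by rw [pair_comm, hwy]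
    refine ⟨u + v - y, w, ?_, hw, ?_⟩
    · simp [IsRoot, *]
    · simp [*]
  · have hyw : D.pair y w = 1 := by rw [pair_comm, hwy]
    refine ⟨u + v - y, u + w - y, ?_, ?_, ?_⟩
    · simp [IsRoot, *]
    · simp [IsRoot, *]
    · simp [*]

-- Product `-2` of a branch with `y` is impossible, as it would make the branch equal to `-y`, whose
-- product with `c` is 1. Product `-1` or 2 for one branch settles the matter; otherwise all
-- products are 0 or 1, and two of them agree.
include hc hu hy hv hw hcy huc hvc hwc huv huw hvw in
theorem hasBranches_of_orthogonal : D.HasBranches c y := by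
  have hvu : D.pair v u = 0 := by rw [pair_comm, huv]
  have hwu : D.pair w u = 0 := by rw [pair_comm, huw]
  have hwv : D.pair w v = 0 := by rw [pair_comm, hvw]
  have hge : ∀ z, D.IsRoot z → D.pair z c = -1 → -2 < D.pair z y := by
    intro z hz hzc
    by_contra! h
    rw [hz.eq_neg_of_le hy h, map_neg, LinearMap.neg_apply, pair_comm, hcy] at hzc
    omega
  have hu' := hge u hu huc
  have hv' := hge v hv hvc
  have hw' := hge w hw hwc
  by_cases hu1 : D.pair u y = -1
  · exact hasBranches_of_eq_neg_one hc hy hu hv hw hcy huc hvc hwc huv huw hvw hu1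
  by_cases hv1 : D.pair v y = -1
  · exact hasBranches_of_eq_neg_one hc hy hv hu hw hcy hvc huc hwc hvu hvw huw hv1
  by_cases hw1 : D.pair w y = -1
  · exact hasBranches_of_eq_neg_one hc hy hw hu hv hcy hwc huc hvc hwu hwv huv hw1
  by_cases hu2 : 2 ≤ D.pair u y
  · exact hasBranches_of_two_le hy hu hv hw hvc hwc huv huw hvw hu2
  by_cases hv2 : 2 ≤ D.pair v y
  · exact hasBranches_of_two_le hy hv hu hw huc hwc hvu hvw huw hv2
  by_cases hw2 : 2 ≤ D.pair w y
  · exact hasBranches_of_two_le hy hw hu hv huc hvc hwu hwv huv hw2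
  have hu3 : D.pair u y = 0 ∨ D.pair u y = 1 := by omega
  have hv3 : D.pair v y = 0 ∨ D.pair v y = 1 := by omega
  have hw3 : D.pair w y = 0 ∨ D.pair w y = 1 := by omega
  rcases hu3 with hu4 | hu4
  · rcases hv3 with hv4 | hv4
    · exact hasBranches_of_eq_zero hu hv huc hvc huv hu4 hv4
    rcases hw3 with hw4 | hw4
    · exact hasBranches_of_eq_zero hu hw huc hwc huw hu4 hw4
    · exact hasBranches_of_eq_one hy hv hw hu hcy hvc hwc huc hvw hvu hwu hv4 hw4 (Or.inl hu4)
  · rcases hv3 with hv4 | hv4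
    · rcases hw3 with hw4 | hw4
      · exact hasBranches_of_eq_zero hv hw hvc hwc hvw hv4 hw4
      · exact hasBranches_of_eq_one hy hu hw hv hcy huc hwc hvc huw huv hwv hu4 hw4 (Or.inl hv4)
    · exact hasBranches_of_eq_one hy hu hv hw hcy huc hvc hwc huv huw hvw hu4 hv4 hw3

end Branches

theorem IsRoot.hasBranches {x y : B → ℤ} (hx : D.IsRoot x) (hy : D.IsRoot y)
    (hxy : D.pair x y = -1) : D.HasBranches x y := by
  revert y
  refine hx.induction (p := fun x => ∀ {y}, D.IsRoot y → D.pair x y = -1 → D.HasBranches x y)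
    (fun hy hxy => ?_) fun i x _ h y hy hxy => ?_
  · have hb := D.branch_injective
    refine hasBranches_of_orthogonal (u := Pi.single (D.branch 0) 1)
      (v := Pi.single (D.branch 1) 1) (w := Pi.single (D.branch 2) 1) (D.isRoot_single _) hy
      (D.isRoot_single _) (D.isRoot_single _) (D.isRoot_single _) hxy ?_ ?_ ?_ ?_ ?_ ?_
    all_goals rw [pair_single]
    iterate 3 rw [D.gram_comm, D.gram_center_branch]
    all_goals exact D.gram_branch_branch _ _ (by decide)
  · exact (h (hy.simpleRefl i) (by rw [← pair_simpleRefl_left, hxy])).simpleRefl i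

end SimplyLaced

/-! ### The invariant form of a Coxeter matrix and its integral lattice. -/

section CoxeterForm

variable {B : Type*}

/-- The inclusion of the root lattice. -/
def intVec : (B → ℤ) →+ (B → ℂ) := (Int.castAddHom ℂ).compLeft B

theorem intVec_apply (x : B → ℤ) (i : B) : intVec x i = x i := rfl

theorem intVec_single [DecidableEq B] (i : B) :
    intVec (Pi.single i 1 : B → ℤ) = Pi.single i 1 := by
  ext j
  simp [intVec_apply, Pi.single_apply]

variable [Fintype B]

/-- Twice the canonical bilinear form of a Coxeter matrix. -/
def coxeterForm (M : CoxeterMatrix B) : (B → ℂ) →ₗ[ℂ] Module.Dual ℂ (B → ℂ) :=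
  ∑ i, (LinearMap.proj i : (B → ℂ) →ₗ[ℂ] ℂ).smulRight (simpleCoroot M i)

theorem coxeterForm_apply (M : CoxeterMatrix B) (x y : B → ℂ) :
    coxeterForm M x y = ∑ i, x i * simpleCoroot M i y := by
  simp [coxeterForm]

variable [DecidableEq B]

theorem coxeterForm_single (M : CoxeterMatrix B) (i : B) :
    coxeterForm M (Pi.single i 1) = simpleCoroot M i := by
  refine LinearMap.ext fun y => ?_
  simp [coxeterForm_apply, Pi.single_apply]

theorem simpleCoroot_apply (M : CoxeterMatrix B) (i : B) (x : B → ℂ) :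
    simpleCoroot M i x = ∑ j, x j * simpleCoroot M i (Pi.single j 1) := by
  have h : x = ∑ j, x j • (Pi.single j 1 : B → ℂ) := by
    ext k
    simp [Pi.single_apply]
  conv_lhs => rw [h]
  simp only [map_sum, map_smul, smul_eq_mul]

theorem simpleCoroot_comm (M : CoxeterMatrix B) (i j : B) :
    simpleCoroot M i (Pi.single j 1) = simpleCoroot M j (Pi.single i 1) := by
  simp [simpleCoroot, Pi.single_apply, M.symmetric i j]

theorem coxeterForm_apply_single (M : CoxeterMatrix B) (x : B → ℂ) (j : B) :
    coxeterForm M x (Pi.single j 1) = simpleCoroot M j x := by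
  rw [coxeterForm_apply, simpleCoroot_apply]
  simp only [simpleCoroot_comm M j]

theorem simpleReflection_apply (M : CoxeterMatrix B) (i : B) (x : B → ℂ) :
    simpleReflection M i x = x - simpleCoroot M i x • Pi.single i 1 :=
  Module.reflection_apply _ _

theorem simpleReflection_inv (M : CoxeterMatrix B) (i : B) :
    (simpleReflection M i)⁻¹ = simpleReflection M i := rfl

theorem coxeterForm_simpleReflection (M : CoxeterMatrix B) (i : B) (x y : B → ℂ) :
    coxeterForm M (simpleReflection M i x) (simpleReflection M i y) = coxeterForm M x y := by
  simp only [simpleReflection_apply, map_sub, map_smul, LinearMap.sub_apply, LinearMap.smul_apply,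
    coxeterForm_single, coxeterForm_apply_single, simpleCoroot_single, smul_eq_mul]
  ring

theorem coxeterForm_invariant {M : CoxeterMatrix B} {w : (B → ℂ) ≃ₗ[ℂ] (B → ℂ)}
    (hw : w ∈ coxeterReflectionGroup M) (x y : B → ℂ) :
    coxeterForm M (w x) (w y) = coxeterForm M x y := by
  revert x y
  refine Subgroup.closure_induction (p := fun w _ => ∀ x y,
    coxeterForm M (w x) (w y) = coxeterForm M x y) ?_ (fun _ _ => rfl) ?_ ?_ hw
  · rintro _ ⟨i, rfl⟩
    exact coxeterForm_simpleReflection M i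
  · intro v w _ _ hv hw x y
    exact (hv _ _).trans (hw x y)
  · intro w _ hw x y
    rw [← hw]
    simp

/-- The elements of a Coxeter group move integral weights by elements of the root lattice. -/
theorem exists_sub_eq_intVec {M : CoxeterMatrix B} {w : (B → ℂ) ≃ₗ[ℂ] (B → ℂ)}
    (hM : ∀ i j, ∃ m : ℤ, simpleCoroot M i (Pi.single j 1) = m)
    (hw : w ∈ coxeterReflectionGroup M) {x : B → ℂ} (hx : ∀ i, ∃ m : ℤ, simpleCoroot M i x = m) :
    ∃ z : B → ℤ, w x - x = intVec z := by
  choose G hG using hM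
  have hint : ∀ i (z : B → ℤ), ∃ m : ℤ, simpleCoroot M i (intVec z) = m := by
    intro i z
    refine ⟨∑ j, z j * G i j, ?_⟩
    rw [simpleCoroot_apply]
    simp [hG, intVec_apply]
  let p : ((B → ℂ) ≃ₗ[ℂ] (B → ℂ)) → Prop := fun w => ∀ x : B → ℂ,
    (∀ i, ∃ m : ℤ, simpleCoroot M i x = m) → ∃ z : B → ℤ, w x - x = intVec z
  have hmul : ∀ v w, p v → p w → p (v * w) := by
    intro v w hv hw x hx
    obtain ⟨z, hz⟩ := hw x hx
    obtain ⟨t, ht⟩ := hv (w x) (fun i => by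
      obtain ⟨m, hm⟩ := hx i
      obtain ⟨n, hn⟩ := hint i z
      refine ⟨n + m, ?_⟩
      rw [← sub_add_cancel (w x) x, hz, map_add, hn, hm]
      push_cast
      rfl)
    refine ⟨t + z, ?_⟩
    rw [map_add, ← ht, ← hz, LinearEquiv.mul_apply]
    abel
  have hgen : ∀ i, p (simpleReflection M i) := by
    intro i x hx
    obtain ⟨m, hm⟩ := hx i
    refine ⟨-m • Pi.single i 1, ?_⟩
    rw [simpleReflection_apply, hm, map_zsmul, intVec_single, ← Int.cast_smul_eq_zsmul ℂ]
    push_cast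
    module
  -- Pairing the property with that of the inverse lets the inverse step of the closure induction go
  -- through; the generators are involutions.
  have key : p w ∧ p w⁻¹ := by
    refine Subgroup.closure_induction (p := fun w _ => p w ∧ p w⁻¹) ?_ ?_ ?_ ?_ hw
    · rintro _ ⟨i, rfl⟩
      rw [simpleReflection_inv]
      exact ⟨hgen i, hgen i⟩
    · have : p 1 := fun x _ => ⟨0, by simp⟩
      rw [inv_one]
      exact ⟨this, this⟩
    · intro v w _ _ hv hw
      rw [mul_inv_rev]
      exact ⟨hmul _ _ hv.1 hw.1, hmul _ _ hw.2 hv.2⟩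
    · intro w _ hw
      rw [inv_inv]
      exact hw.symm
  exact key.1 x hx

theorem map_ker_coxeterForm (M : CoxeterMatrix B) (i : B) (x : B → ℂ) :
    (LinearMap.ker (coxeterForm M x)).map (simpleReflection M i : (B → ℂ) →ₗ[ℂ] (B → ℂ)) =
      LinearMap.ker (coxeterForm M (simpleReflection M i x)) := by
  ext y
  rw [Submodule.mem_map_equiv, LinearMap.mem_ker, LinearMap.mem_ker,
    ← coxeterForm_simpleReflection M i]
  simp

end CoxeterForm

/-! ### Reflecting hyperplanes and non-modularity for simply laced diagrams. -/

namespace SimplyLaced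

variable {B : Type*} [Fintype B] [DecidableEq B] {D : SimplyLaced B} {M : CoxeterMatrix B}
  (hM : ∀ i j, simpleCoroot M i (Pi.single j 1) = (D.gram i j : ℂ))
include hM

theorem simpleCoroot_intVec (i : B) (x : B → ℤ) :
    simpleCoroot M i (intVec x) = (D.pair (Pi.single i 1) x : ℂ) := by
  rw [simpleCoroot_apply, pair_comm, pair_eq_sum]
  simp [hM, pair_single, intVec_apply, D.gram_comm i]

theorem coxeterForm_intVec (x y : B → ℤ) :
    coxeterForm M (intVec x) (intVec y) = (D.pair x y : ℂ) := by
  rw [coxeterForm_apply, pair_eq_sum]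
  simp [simpleCoroot_intVec hM, intVec_apply]

theorem simpleReflection_intVec (i : B) (x : B → ℤ) :
    simpleReflection M i (intVec x) = intVec (D.simpleRefl i x) := by
  rw [simpleReflection_apply, simpleCoroot_intVec hM, simpleRefl, map_sub, map_zsmul,
    intVec_single, Int.cast_smul_eq_zsmul]

/-- Positive definiteness makes the Gram matrix nonsingular. Pairing a lattice vector with this
weight reads off its `i`-th coordinate. -/
theorem exists_fundamental_weight (i : B) :
    ∃ x : B → ℂ, ∀ j, simpleCoroot M j x = if i = j then 1 else 0 := by
  have hdet : D.gram.det ≠ 0 := by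
    intro h
    obtain ⟨v, hv, h0⟩ := Matrix.exists_mulVec_eq_zero_iff.2 h
    have := D.pos v hv
    rw [Matrix.toLinearMap₂'_apply', h0, dotProduct_zero] at this
    exact lt_irrefl _ this
  have hunit : IsUnit (D.gram.map (Int.cast : ℤ → ℂ)).det := by
    rw [isUnit_iff_ne_zero]
    have : (D.gram.map (Int.cast : ℤ → ℂ)).det = (D.gram.det : ℂ) :=
      ((Int.castRingHom ℂ).map_det D.gram).symm
    rw [this]
    exact_mod_cast hdet
  refine ⟨(D.gram.map (Int.cast : ℤ → ℂ))⁻¹.mulVec (Pi.single i 1), fun j => ?_⟩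
  have h : (D.gram.map (Int.cast : ℤ → ℂ)).mulVec
      ((D.gram.map (Int.cast : ℤ → ℂ))⁻¹.mulVec (Pi.single i 1)) = Pi.single i 1 := by
    rw [Matrix.mulVec_mulVec, Matrix.mul_nonsing_inv _ hunit, Matrix.one_mulVec]
  have := congrFun h j
  rw [simpleCoroot_apply]
  simp only [hM]
  rw [Matrix.mulVec, dotProduct] at this
  simpa [mul_comm, Pi.single_apply, eq_comm] using this

theorem coxeterForm_ne_zero {x : B → ℤ} (hx : D.IsRoot x) : coxeterForm M (intVec x) ≠ 0 := by
  intro h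
  have := coxeterForm_intVec hM x x
  rw [h, hx] at this
  norm_num at this

theorem rank_ker_coxeterForm {x : B → ℤ} (hx : D.IsRoot x) :
    rank (LinearMap.ker (coxeterForm M (intVec x))) = 1 :=
  rank_ker (coxeterForm_ne_zero hM hx)

theorem ker_mem_reflectionArrangement {x : B → ℤ} (hx : D.IsRoot x) :
    LinearMap.ker (coxeterForm M (intVec x)) ∈
      reflectionArrangement (coxeterReflectionGroup M) := by
  have hmem : ∀ i, simpleReflection M i ∈ coxeterReflectionGroup M :=
    fun i => Subgroup.subset_closure ⟨i, rfl⟩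
  refine hx.induction (p := fun x => LinearMap.ker (coxeterForm M (intVec x)) ∈
    reflectionArrangement (coxeterReflectionGroup M)) ?_ fun i x _ h => ?_
  · refine ⟨rank_ker_coxeterForm hM (D.isRoot_single _), _, hmem D.center, ?_⟩
    ext y
    simp [intVec_single, coxeterForm_single, simpleReflection_apply, sub_eq_self]
  · rw [← simpleReflection_intVec hM, ← map_ker_coxeterForm]
    exact map_mem_reflectionArrangement (mem_conj_iff (hmem i)) h

/-- The hyperplanes of the reflection arrangement are orthogonal to roots. -/
theorem exists_root_of_mem_reflectionArrangement {H : Submodule ℂ (B → ℂ)}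
    (hH : H ∈ reflectionArrangement (coxeterReflectionGroup M)) :
    ∃ x, D.IsRoot x ∧ H = LinearMap.ker (coxeterForm M (intVec x)) := by
  obtain ⟨hr, w, hw, rfl⟩ := hH
  have hint : ∀ i j, ∃ m : ℤ, simpleCoroot M i (Pi.single j 1) = m := fun i j => ⟨_, hM i j⟩
  obtain ⟨j, hj⟩ : ∃ j, w (Pi.single j 1) ≠ Pi.single j 1 := by
    by_contra! h
    have hw1 : (w : (B → ℂ) →ₗ[ℂ] (B → ℂ)) = LinearMap.id :=
      (Pi.basisFun ℂ B).ext fun j => by simp [h]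
    have : LinearMap.fixedSubmodule (w : (B → ℂ) →ₗ[ℂ] (B → ℂ)) = ⊤ := by
      ext y
      simp [hw1]
    rw [this, rank_top] at hr
    omega
  obtain ⟨v, hv⟩ := exists_sub_eq_intVec hint hw (fun i => hint i j)
  have hv0 : v ≠ 0 := by
    rintro rfl
    rw [map_zero, sub_eq_zero] at hv
    exact hj hv
  -- The displacement `v` of a simple root may be a multiple of the desired root, so pass to the
  -- primitive vector `u` with `v = d u`.
  obtain ⟨u, hu, hgcd⟩ := Finset.extract_gcd v (s := Finset.univ) (by
    obtain ⟨i, -⟩ := Function.ne_iff.1 hv0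
    exact ⟨i, Finset.mem_univ i⟩)
  set d := Finset.univ.gcd v with hd
  have hvu : v = d • u := by
    ext i
    simp [hu i (Finset.mem_univ i)]
  have hd0 : d ≠ 0 := by
    rintro h
    rw [h, zero_smul] at hvu
    exact hv0 hvu
  have hu0 : u ≠ 0 := by
    rintro rfl
    simp [hvu] at hv0
  have hq : (D.pair u u : ℂ) ≠ 0 := by exact_mod_cast (D.pair_pos hu0).ne'
  have hd0' : (d : ℂ) ≠ 0 := by exact_mod_cast hd0
  have hvd : intVec v = (d : ℂ) • intVec u := by
    rw [hvu, map_zsmul, Int.cast_smul_eq_zsmul]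
  -- Since `e_j` and `e_j + v` have the same norm, `(v, e_j) = -(v, v) / 2`. It follows that `w` is
  -- the reflection `y ↦ y - 2 (u, y) / (u, u) • u`.
  have hform : coxeterForm M (intVec v) (Pi.single j 1) = -((d : ℂ) ^ 2 * D.pair u u) / 2 := by
    have h1 : (d : ℂ) ^ 2 * D.pair u u = coxeterForm M (intVec v) (intVec v) := by
      rw [hvd, map_smul, map_smul, LinearMap.smul_apply, coxeterForm_intVec hM]
      simp only [smul_eq_mul]
      ring
    have h2 : coxeterForm M (w (Pi.single j 1)) (w (Pi.single j 1)) = 2 := by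
      rw [coxeterForm_invariant hw, coxeterForm_single, simpleCoroot_single]
    have h3 : coxeterForm M (Pi.single j 1) (w (Pi.single j 1)) =
        coxeterForm M (w (Pi.single j 1)) (Pi.single j 1) := by
      rw [coxeterForm_single, coxeterForm_apply_single]
    rw [h1, ← hv]
    simp only [map_sub, LinearMap.sub_apply, h2, h3]
    rw [coxeterForm_single, simpleCoroot_single]
    ring
  obtain ⟨hfix, hwy⟩ := fixed_eq_ker_of_rank_eq_one (coxeterForm M) (map_sub _)
    (coxeterForm_invariant hw) hr (x := Pi.single j 1) (by
      rw [hv, hform]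
      simp [hq, hd0'])
  rw [hv] at hfix hwy
  refine ⟨u, ?_, ?_⟩
  · have hdvd : ∀ i k, D.pair u u ∣ 2 * u i * u k := by
      intro i k
      obtain ⟨x, hx⟩ := exists_fundamental_weight hM i
      obtain ⟨z, hz⟩ := exists_sub_eq_intVec hint hw (x := x) fun l => by
        rw [hx]
        split_ifs
        · exact ⟨1, by simp⟩
        · exact ⟨0, by simp⟩
      have hux : coxeterForm M (intVec u) x = u i := by
        simp [coxeterForm_apply, hx, intVec_apply]
      rw [hwy x, add_sub_cancel_left, hform, hvd, map_smul, LinearMap.smul_apply, hux] at hz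
      have hzk := congrFun hz k
      simp only [Pi.smul_apply, smul_eq_mul, intVec_apply] at hzk
      refine ⟨-z k, ?_⟩
      have : (2 * u i * u k : ℂ) = D.pair u u * -z k := by
        rw [← hzk]
        field_simp
      exact_mod_cast this
    have h1 : ∀ i, D.pair u u ∣ 2 * u i := by
      intro i
      have := Finset.dvd_gcd (s := Finset.univ) (f := fun k => 2 * u i * u k)
        fun k _ => hdvd i k
      rw [Finset.gcd_mul_left, hgcd, mul_one] at this
      exact (dvd_normalize_iff).1 this
    have h2 := Finset.dvd_gcd (s := Finset.univ) (f := fun k => 2 * u k) fun k _ => h1 k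
    rw [Finset.gcd_mul_left, hgcd, mul_one, dvd_normalize_iff] at h2
    exact le_antisymm (Int.le_of_dvd (by norm_num) h2) (D.two_le_pair_self hu0)
  · rw [hfix, hvd, map_smul]
    ext y
    simp [hd0']

theorem not_isModular_of_orthogonal {x y : B → ℤ} (hx : D.IsRoot x) (hy : D.IsRoot y)
    (hxy : D.pair x y = 0) :
    ¬ IsModular (reflectionArrangement (coxeterReflectionGroup M))
      (LinearMap.ker (coxeterForm M (intVec x)) ⊓ LinearMap.ker (coxeterForm M (intVec y))) := by
  obtain ⟨z, hz, hzx, hzy⟩ := exists_pair_eq_one hx hy hxy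
  have hyx : D.pair y x = 0 := by rw [pair_comm, hxy]
  have hxz : D.pair x z = 1 := by rw [pair_comm, hzx]
  have hyz : D.pair y z = 1 := by rw [pair_comm, hzy]
  have hxx : D.pair x x = 2 := hx
  have hyy : D.pair y y = 2 := hy
  have hzz : D.pair z z = 2 := hz
  have ht : D.IsRoot (x + y - z) := by simp [IsRoot, *]
  refine not_isModular (Y := LinearMap.ker (coxeterForm M (intVec z)) ⊓
    LinearMap.ker (coxeterForm M (intVec (x + y - z))))
    (K := LinearMap.ker (coxeterForm M (intVec (x + y))))
    (inf_mem_intersectionLattice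
      (mem_intersectionLattice (ker_mem_reflectionArrangement hM hz))
      (mem_intersectionLattice (ker_mem_reflectionArrangement hM ht))) ?_ ?_ ?_ ?_
  · rintro v ⟨h1, h2⟩
    rw [SetLike.mem_coe, LinearMap.mem_ker] at h1 h2
    simp [h1, h2]
  · rintro v ⟨h1, h2⟩
    rw [SetLike.mem_coe, LinearMap.mem_ker] at h1 h2
    have h3 : x + y = x + y - z + z := by abel
    rw [LinearMap.mem_ker, h3, map_add, map_add, LinearMap.add_apply, h1, h2, add_zero]
  · intro h
    have h1 : intVec x ∈ LinearMap.ker (coxeterForm M (intVec (x + y))) := h ▸ Submodule.mem_top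
    rw [LinearMap.mem_ker, coxeterForm_intVec hM] at h1
    simp [hyx, hxx] at h1
  · intro H hH h1 h2
    obtain ⟨r, hr, rfl⟩ := exists_root_of_mem_reflectionArrangement hM hH
    have hrr : D.pair r r = 2 := hr
    obtain ⟨a, b, hab⟩ := exists_of_ker_inf_ker_le h1
    obtain ⟨c, d, hcd⟩ := exists_of_ker_inf_ker_le h2
    have e1 := LinearMap.congr_fun hab (intVec x)
    have e2 := LinearMap.congr_fun hab (intVec y)
    have e3 := LinearMap.congr_fun hab (intVec r)
    have e4 := LinearMap.congr_fun hcd (intVec x)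
    have e5 := LinearMap.congr_fun hcd (intVec y)
    simp only [LinearMap.add_apply, LinearMap.smul_apply, coxeterForm_intVec hM, smul_eq_mul,
      map_add, map_sub, LinearMap.sub_apply, hxx, hyy, hxy, hyx, hzx, hzy, hrr,
      D.pair_comm x r, D.pair_comm y r] at e1 e2 e3 e4 e5
    -- A root `r` in the span of `z` and `x + y - z` has equal products with `x` and `y`. Being also
    -- in the plane of `x` and `y`, it is `a (x + y)`, so `(r, x)² = 4 a² = (r, r) = 2`.
    have hm : ((D.pair r x * D.pair r x : ℤ) : ℂ) = (2 : ℤ) := by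
      push_cast at *
      grind
    have hm' : D.pair r x * D.pair r x = 2 := by exact_mod_cast hm
    have h5 : D.pair r x < 2 := by nlinarith
    have h6 : -2 < D.pair r x := by nlinarith
    interval_cases D.pair r x <;> omega

theorem not_isModular_of_pair_eq_neg_one {x y : B → ℤ} (hx : D.IsRoot x) (hy : D.IsRoot y)
    (hxy : D.pair x y = -1) :
    ¬ IsModular (reflectionArrangement (coxeterReflectionGroup M))
      (LinearMap.ker (coxeterForm M (intVec x)) ⊓ LinearMap.ker (coxeterForm M (intVec y))) := by
  obtain ⟨z, t, hz, ht, hzx, htx, hzy, hty, hzt⟩ := hx.hasBranches hy hxy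
  have hyx : D.pair y x = -1 := by rw [pair_comm, hxy]
  have hxz : D.pair x z = -1 := by rw [pair_comm, hzx]
  have hyz : D.pair y z = 0 := by rw [pair_comm, hzy]
  have hxt : D.pair x t = -1 := by rw [pair_comm, htx]
  have hyt : D.pair y t = 0 := by rw [pair_comm, hty]
  have htz : D.pair t z = 0 := by rw [pair_comm, hzt]
  have hxx : D.pair x x = 2 := hx
  have hyy : D.pair y y = 2 := hy
  have hzz : D.pair z z = 2 := hz
  have htt : D.pair t t = 2 := ht
  -- The highest root of the `D₄` with center `x` and leaves `y`, `z`, `t`. Like `z` and `t` it is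
  -- orthogonal to `y`.
  have hu : D.IsRoot (x + x + y + z + t) := by simp [IsRoot, *]
  refine not_isModular (Y := LinearMap.ker (coxeterForm M (intVec (x + x + y + z + t))) ⊓
    LinearMap.ker (coxeterForm M (intVec z)) ⊓ LinearMap.ker (coxeterForm M (intVec t)))
    (K := LinearMap.ker (coxeterForm M (intVec (x + x + y))))
    (inf_mem_intersectionLattice (inf_mem_intersectionLattice
      (mem_intersectionLattice (ker_mem_reflectionArrangement hM hu))
      (mem_intersectionLattice (ker_mem_reflectionArrangement hM hz)))
      (mem_intersectionLattice (ker_mem_reflectionArrangement hM ht))) ?_ ?_ ?_ ?_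
  · rintro v ⟨h1, h2⟩
    rw [SetLike.mem_coe, LinearMap.mem_ker] at h1 h2
    simp [h1, h2]
  · rintro v ⟨⟨h1, h2⟩, h3⟩
    rw [SetLike.mem_coe, LinearMap.mem_ker] at h1 h2 h3
    have h4 : x + x + y = x + x + y + z + t - z - t := by abel
    rw [LinearMap.mem_ker, h4, map_sub, map_sub, map_sub, map_sub, LinearMap.sub_apply,
      LinearMap.sub_apply, h1, h2, h3, sub_zero, sub_zero]
  · intro h
    have h1 : intVec x ∈ LinearMap.ker (coxeterForm M (intVec (x + x + y))) :=
      h ▸ Submodule.mem_top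
    rw [LinearMap.mem_ker, coxeterForm_intVec hM] at h1
    simp [hyx, hxx] at h1
  · intro H hH h1 h2
    obtain ⟨r, hr, rfl⟩ := exists_root_of_mem_reflectionArrangement hM hH
    have hrr : D.pair r r = 2 := hr
    obtain ⟨a, b, hab⟩ := exists_of_ker_inf_ker_le h1
    obtain ⟨c, d, e, hcd⟩ := exists_of_ker_inf_ker_inf_ker_le h2
    have e1 := LinearMap.congr_fun hab (intVec x)
    have e2 := LinearMap.congr_fun hab (intVec y)
    have e3 := LinearMap.congr_fun hab (intVec r)
    have e5 := LinearMap.congr_fun hcd (intVec y)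
    simp only [LinearMap.add_apply, LinearMap.smul_apply, coxeterForm_intVec hM, smul_eq_mul,
      map_add, hxx, hyy, hxy, hyx, hzy, hty, hrr,
      D.pair_comm x r, D.pair_comm y r] at e1 e2 e3 e5
    -- As a combination of roots orthogonal to `y`, the root `r` is orthogonal to `y`. Within the
    -- plane of `x` and `y` this means `r = b (2x + y)`, so `6 b² = 2` and `(r, x)² = 9 b² = 3`.
    have hm : ((D.pair r x * D.pair r x : ℤ) : ℂ) = (3 : ℤ) := by
      push_cast at *
      grind
    have hm' : D.pair r x * D.pair r x = 3 := by exact_mod_cast hm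
    have h5 : D.pair r x < 2 := by nlinarith
    have h6 : -2 < D.pair r x := by nlinarith
    interval_cases D.pair r x <;> omega

theorem no_modular_rank_two (X : Submodule ℂ (B → ℂ))
    (hX : IsModular (reflectionArrangement (coxeterReflectionGroup M)) X) : rank X ≠ 2 := by
  intro hr
  obtain ⟨H₁, h₁, H₂, h₂, hne, rfl⟩ := exists_eq_inf_of_rank_eq_two (fun H hH => hH.1) hX.1 hr
  obtain ⟨x, hx, rfl⟩ := exists_root_of_mem_reflectionArrangement hM h₁
  obtain ⟨y, hy, rfl⟩ := exists_root_of_mem_reflectionArrangement hM h₂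
  have hneg : LinearMap.ker (coxeterForm M (intVec (-y))) =
      LinearMap.ker (coxeterForm M (intVec y)) := by
    ext v
    simp
  have hxy : x ≠ y := by
    rintro rfl
    exact hne rfl
  have hxy' : x ≠ -y := by
    rintro rfl
    exact hne hneg
  rcases hx.pair_cases hy hxy hxy' with h | h | h
  · exact not_isModular_of_pair_eq_neg_one hM hx hy h hX
  · exact not_isModular_of_orthogonal hM hx hy h hX
  · rw [← hneg] at hX
    exact not_isModular_of_pair_eq_neg_one hM hx hy.neg (by rw [map_neg, h]) hX

theorem nontrivial_reflectionArrangement :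
    (reflectionArrangement (coxeterReflectionGroup M)).Nontrivial := by
  refine ⟨_, ker_mem_reflectionArrangement hM (D.isRoot_single (D.branch 0)), _,
    ker_mem_reflectionArrangement hM (D.isRoot_single (D.branch 1)), fun h => ?_⟩
  have h1 : intVec (Pi.single (D.branch 1) 1) ∈
      LinearMap.ker (coxeterForm M (intVec (Pi.single (D.branch 0) 1))) := by
    rw [LinearMap.mem_ker, coxeterForm_intVec hM, pair_single,
      D.gram_branch_branch _ _ (by decide), Int.cast_zero]
  rw [h, LinearMap.mem_ker, coxeterForm_intVec hM, pair_single, D.gram_self] at h1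
  norm_num at h1

end SimplyLaced

/-! ### Simply laced diagrams from Coxeter matrices with entries 1, 2, 3. -/

section SimplyLacedTypes

variable {B : Type*}

/-- The Cartan matrix of a Coxeter matrix with entries `1`, `2` and `3`. -/
def cartanOfCoxeter (M : CoxeterMatrix B) : Matrix B B ℤ :=
  Matrix.of fun i j => if M i j = 1 then 2 else if M i j = 3 then -1 else 0

variable [Fintype B] [DecidableEq B]

theorem simpleCoroot_single_eq_cartanOfCoxeter {M : CoxeterMatrix B}
    (h : ∀ i j, M i j = 1 ∨ M i j = 2 ∨ M i j = 3) (i j : B) :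
    simpleCoroot M i (Pi.single j 1) = (cartanOfCoxeter M i j : ℂ) := by
  rcases h i j with h | h | h
  · exact simpleCoroot_of_eq h (neg_two_mul_cos_pi_div_one.trans (by simp [cartanOfCoxeter, h]))
  · exact simpleCoroot_of_eq h (neg_two_mul_cos_pi_div_two.trans (by simp [cartanOfCoxeter, h]))
  · exact simpleCoroot_of_eq h (neg_two_mul_cos_pi_div_three.trans (by simp [cartanOfCoxeter, h]))

/-- The simply laced diagram of a Coxeter matrix. Connectedness is witnessed by a height function
that decreases along some edge at each node other than the branch node. -/
def SimplyLaced.ofCoxeterMatrix (M : CoxeterMatrix B)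
    (pos : ∀ x : B → ℤ, x ≠ 0 → 0 < Matrix.toLinearMap₂' ℤ (cartanOfCoxeter M) x x)
    (center : B) (branch : Fin 3 → B) (branch_injective : Function.Injective branch)
    (center_branch : ∀ k, M center (branch k) = 3)
    (branch_branch : ∀ k l, k ≠ l → M (branch k) (branch l) = 2)
    (height : B → ℕ) (height_lt : ∀ i, i ≠ center → ∃ j, height j < height i ∧ M j i = 3) :
    SimplyLaced B where
  gram := cartanOfCoxeter M
  gram_comm i j := by simp [cartanOfCoxeter, M.symmetric i j]
  gram_self i := by simp [cartanOfCoxeter]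
  gram_of_ne i j hij := by
    simp only [cartanOfCoxeter, Matrix.of_apply, if_neg (M.off_diagonal i j hij)]
    split_ifs <;> simp
  pos := pos
  center := center
  branch := branch
  branch_injective := branch_injective
  gram_center_branch k := by simp [cartanOfCoxeter, center_branch]
  gram_branch_branch k l hkl := by simp [cartanOfCoxeter, branch_branch k l hkl]
  connected i := by
    induction h : height i using Nat.strong_induction_on generalizing i with
    | _ n ih =>
      subst h
      by_cases hi : i = center
      · rw [hi]
      · obtain ⟨j, hj, hji⟩ := height_lt i hi
        exact (ih _ hj j rfl).tail (by simp [cartanOfCoxeter, hji])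

/-- The conclusions for the reflection group of a simply laced diagram with a branch node. -/
theorem SimplyLaced.no_modular_rank_two_of_hasCoxeterType {M : CoxeterMatrix B}
    {D : SimplyLaced B} (hD : D.gram = cartanOfCoxeter M)
    (h : ∀ i j, M i j = 1 ∨ M i j = 2 ∨ M i j = 3)
    {V : Type*} [AddCommGroup V] [Module ℂ V] [FiniteDimensional ℂ V]
    {W : Subgroup (V ≃ₗ[ℂ] V)} (hW : HasCoxeterType M W) :
    (¬ ∃ X : Submodule ℂ V, IsModular (reflectionArrangement W) X ∧ rank X = 2) ∧
      ¬ IsSupersolvable (reflectionArrangement W) := by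
  have hM : ∀ i j, simpleCoroot M i (Pi.single j 1) = (D.gram i j : ℂ) := fun i j => by
    rw [hD, simpleCoroot_single_eq_cartanOfCoxeter h]
  exact IsLinearlyConjugate.no_modular_rank_two hW (no_modular_rank_two hM)
    (nontrivial_reflectionArrangement hM)

end SimplyLacedTypes

/-! ### Types E₆, E₇ and E₈. -/

section TypeE

/-- The quadratic form of type `E₈` is positive definite. -/
theorem eq_zero_of_formE8_le {a b c d e f g h : ℤ}
    (hq : a * a + b * b + c * c + d * d + e * e + f * f + g * g + h * h - a * c - b * d - c * d -
      d * e - e * f - f * g - g * h ≤ 0) :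
    a = 0 ∧ b = 0 ∧ c = 0 ∧ d = 0 ∧ e = 0 ∧ f = 0 ∧ g = 0 ∧ h = 0 := by
  -- Completing squares along the three arms towards the branch node `d` leaves `d²` with
  -- coefficient `1 - 1/4 - 1/3 - 2/5 = 1/60`; everything is multiplied by 120. Types E₆ and E₇ are
  -- obtained by setting the last variables to zero.
  have key : 30 * (2 * b - d) ^ 2 + 30 * (2 * a - c) ^ 2 + 10 * (3 * c - 2 * d) ^ 2 +
      30 * (2 * h - g) ^ 2 + 10 * (3 * g - 2 * f) ^ 2 + 5 * (4 * f - 3 * e) ^ 2 +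
      3 * (5 * e - 4 * d) ^ 2 + 2 * d ^ 2 ≤ 0 := by
    linear_combination 120 * hq
  have zero : ∀ {t : ℤ}, t ^ 2 ≤ 0 → t = 0 := fun ht =>
    pow_eq_zero_iff two_ne_zero |>.1 (le_antisymm ht (sq_nonneg _))
  have h1 := sq_nonneg (2 * b - d)
  have h2 := sq_nonneg (2 * a - c)
  have h3 := sq_nonneg (3 * c - 2 * d)
  have h4 := sq_nonneg (2 * h - g)
  have h5 := sq_nonneg (3 * g - 2 * f)
  have h6 := sq_nonneg (4 * f - 3 * e)
  have h7 := sq_nonneg (5 * e - 4 * d)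
  have h8 := sq_nonneg d
  have e1 : 2 * b - d = 0 := zero (by linarith)
  have e2 : 2 * a - c = 0 := zero (by linarith)
  have e3 : 3 * c - 2 * d = 0 := zero (by linarith)
  have e4 : 2 * h - g = 0 := zero (by linarith)
  have e5 : 3 * g - 2 * f = 0 := zero (by linarith)
  have e6 : 4 * f - 3 * e = 0 := zero (by linarith)
  have e7 : 5 * e - 4 * d = 0 := zero (by linarith)
  have e8 : d = 0 := zero (by linarith)
  omega

theorem posE6 (x : Fin 6 → ℤ) (hx : x ≠ 0) :
    0 < Matrix.toLinearMap₂' ℤ (cartanOfCoxeter CoxeterMatrix.E₆) x x := by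
  by_contra! h
  refine hx ?_
  rw [Matrix.toLinearMap₂'_apply] at h
  simp [Fin.sum_univ_succ, cartanOfCoxeter, CoxeterMatrix.E₆] at h
  have := eq_zero_of_formE8_le (a := x 0) (b := x 1) (c := x 2) (d := x 3) (e := x 4) (f := x 5)
    (g := 0) (h := 0) (by linarith)
  ext i
  fin_cases i <;> simp [this]

theorem posE7 (x : Fin 7 → ℤ) (hx : x ≠ 0) :
    0 < Matrix.toLinearMap₂' ℤ (cartanOfCoxeter CoxeterMatrix.E₇) x x := by
  by_contra! h
  refine hx ?_
  rw [Matrix.toLinearMap₂'_apply] at h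
  simp [Fin.sum_univ_succ, cartanOfCoxeter, CoxeterMatrix.E₇] at h
  have := eq_zero_of_formE8_le (a := x 0) (b := x 1) (c := x 2) (d := x 3) (e := x 4) (f := x 5)
    (g := x 6) (h := 0) (by linarith)
  ext i
  fin_cases i <;> simp [this]

theorem posE8 (x : Fin 8 → ℤ) (hx : x ≠ 0) :
    0 < Matrix.toLinearMap₂' ℤ (cartanOfCoxeter CoxeterMatrix.E₈) x x := by
  by_contra! h
  refine hx ?_
  rw [Matrix.toLinearMap₂'_apply] at h
  simp [Fin.sum_univ_succ, cartanOfCoxeter, CoxeterMatrix.E₈] at h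
  have := eq_zero_of_formE8_le (a := x 0) (b := x 1) (c := x 2) (d := x 3) (e := x 4) (f := x 5)
    (g := x 6) (h := x 7) (by linarith)
  ext i
  fin_cases i <;> simp [this]

/-- The diagram of type `E₆`. -/
def diagramE6 : SimplyLaced (Fin 6) :=
  .ofCoxeterMatrix CoxeterMatrix.E₆ posE6 3 ![1, 2, 4] (by decide) (by decide) (by decide)
    ![2, 1, 1, 0, 1, 2] (by decide)

/-- The diagram of type `E₇`. -/
def diagramE7 : SimplyLaced (Fin 7) :=
  .ofCoxeterMatrix CoxeterMatrix.E₇ posE7 3 ![1, 2, 4] (by decide) (by decide) (by decide)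
    ![2, 1, 1, 0, 1, 2, 3] (by decide)

/-- The diagram of type `E₈`. -/
def diagramE8 : SimplyLaced (Fin 8) :=
  .ofCoxeterMatrix CoxeterMatrix.E₈ posE8 3 ![1, 2, 4] (by decide) (by decide) (by decide)
    ![2, 1, 1, 0, 1, 2, 3, 4] (by decide)

theorem coxeterMatrixE6_cases (i j : Fin 6) : CoxeterMatrix.E₆ i j = 1 ∨
    CoxeterMatrix.E₆ i j = 2 ∨ CoxeterMatrix.E₆ i j = 3 := by
  fin_cases i <;> fin_cases j <;> decide

theorem coxeterMatrixE7_cases (i j : Fin 7) : CoxeterMatrix.E₇ i j = 1 ∨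
    CoxeterMatrix.E₇ i j = 2 ∨ CoxeterMatrix.E₇ i j = 3 := by
  fin_cases i <;> fin_cases j <;> decide

theorem coxeterMatrixE8_cases (i j : Fin 8) : CoxeterMatrix.E₈ i j = 1 ∨
    CoxeterMatrix.E₈ i j = 2 ∨ CoxeterMatrix.E₈ i j = 3 := by
  fin_cases i <;> fin_cases j <;> decide

end TypeE

/-! ### Type D, realized by the vectors `eᵢ - eᵢ₊₁` and the sum of the last two unit vectors. -/

section TypeD

/-- The coordinates of the simple roots of type `D`. -/
def simpleRootsD (n : ℕ) : Matrix (Fin (n + 2)) (Fin (n + 2)) ℤ :=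
  Matrix.of fun i => if h : (i : ℕ) < n + 1 then
    Pi.single i 1 - Pi.single ⟨i + 1, by omega⟩ 1
  else Pi.single i 1 + Pi.single ⟨n, by omega⟩ 1

theorem simpleRootsD_of_lt {n : ℕ} {i : Fin (n + 2)} (h : (i : ℕ) < n + 1) :
    simpleRootsD n i = Pi.single i 1 - Pi.single ⟨i + 1, by omega⟩ 1 := by
  funext k
  rw [simpleRootsD, Matrix.of_apply, dif_pos h]

theorem simpleRootsD_of_not_lt {n : ℕ} {i : Fin (n + 2)} (h : ¬ (i : ℕ) < n + 1) :
    simpleRootsD n i = Pi.single i 1 + Pi.single ⟨n, by omega⟩ 1 := by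
  funext k
  rw [simpleRootsD, Matrix.of_apply, dif_neg h]

theorem coxeterMatrixD_apply (l : ℕ) (i j : Fin l) : coxeterMatrixD l i j =
    if i = j then 1
    else if ((i : ℕ) + 1 = j ∧ (j : ℕ) + 1 < l) ∨ ((j : ℕ) + 1 = i ∧ (i : ℕ) + 1 < l) ∨
        ((i : ℕ) + 3 = l ∧ (j : ℕ) + 1 = l) ∨ ((j : ℕ) + 3 = l ∧ (i : ℕ) + 1 = l) then 3
    else 2 := rfl

theorem cartanOfCoxeter_coxeterMatrixD (l : ℕ) (i j : Fin l) :
    cartanOfCoxeter (coxeterMatrixD l) i j =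
    if i = j then 2
    else if ((i : ℕ) + 1 = j ∧ (j : ℕ) + 1 < l) ∨ ((j : ℕ) + 1 = i ∧ (i : ℕ) + 1 < l) ∨
        ((i : ℕ) + 3 = l ∧ (j : ℕ) + 1 = l) ∨ ((j : ℕ) + 3 = l ∧ (i : ℕ) + 1 = l) then -1
    else 0 := by
  rw [cartanOfCoxeter, Matrix.of_apply, coxeterMatrixD_apply]
  split_ifs <;> simp_all

theorem simpleRootsD_mul_transpose (n : ℕ) :
    simpleRootsD (n + 1) * (simpleRootsD (n + 1)).transpose =
      cartanOfCoxeter (coxeterMatrixD (n + 3)) := by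
  ext i j
  have hi := i.2
  have hj := j.2
  rw [Matrix.mul_apply', cartanOfCoxeter_coxeterMatrixD]
  change simpleRootsD (n + 1) i ⬝ᵥ simpleRootsD (n + 1) j = _
  by_cases h1 : (i : ℕ) < n + 1 + 1 <;> by_cases h2 : (j : ℕ) < n + 1 + 1
  · rw [simpleRootsD_of_lt h1, simpleRootsD_of_lt h2]
    simp only [sub_dotProduct, dotProduct_sub, single_one_dotProduct, Pi.single_apply, Fin.ext_iff]
    split_ifs <;> omega
  · rw [simpleRootsD_of_lt h1, simpleRootsD_of_not_lt h2]
    simp only [sub_dotProduct, dotProduct_add, single_one_dotProduct, Pi.single_apply, Fin.ext_iff]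
    split_ifs <;> omega
  · rw [simpleRootsD_of_not_lt h1, simpleRootsD_of_lt h2]
    simp only [add_dotProduct, dotProduct_sub, single_one_dotProduct, Pi.single_apply, Fin.ext_iff]
    split_ifs <;> omega
  · rw [simpleRootsD_of_not_lt h1, simpleRootsD_of_not_lt h2]
    simp only [add_dotProduct, dotProduct_add, single_one_dotProduct, Pi.single_apply, Fin.ext_iff]
    split_ifs <;> omega

/-- The first coordinates give `x₀ = 0` and `x_k = x_{k-1}` for `k < n`, so all `x_k` with `k < n`
vanish. The last two coordinates then read `x_n + x_{n+1} = 0` and `x_{n+1} - x_n = 0`. -/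
theorem vecMul_simpleRootsD_eq_zero {n : ℕ} {x : Fin (n + 2) → ℤ}
    (hx : Matrix.vecMul x (simpleRootsD n) = 0) : x = 0 := by
  have coord : ∀ k : Fin (n + 2), x k + ∑ i : Fin (n + 2), x i *
      (if (i : ℕ) < n + 1 then (if (i : ℕ) + 1 = k then -1 else 0)
        else if n = k then 1 else 0) = 0 := by
    intro k
    have hk : x k = ∑ i, x i * (if k = i then 1 else 0) := by simp
    rw [hk, ← Finset.sum_add_distrib]
    refine Eq.trans (Finset.sum_congr rfl fun i _ => ?_) (congrFun hx k)
    rw [← mul_add]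
    change _ = x i * simpleRootsD n i k
    congr 1
    by_cases h : (i : ℕ) < n + 1
    · rw [simpleRootsD_of_lt h]
      simp only [Pi.sub_apply, Pi.single_apply, Fin.ext_iff]
      split_ifs <;> omega
    · rw [simpleRootsD_of_not_lt h]
      simp only [Pi.add_apply, Pi.single_apply, Fin.ext_iff]
      split_ifs <;> omega
  have low : ∀ m : ℕ, ∀ hm : m < n, x ⟨m, by omega⟩ = 0 := by
    intro m
    induction m with
    | zero =>
      intro hm
      have h := coord ⟨0, by omega⟩
      rwa [Finset.sum_eq_zero, add_zero] at h
      intro i _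
      rw [mul_eq_zero]
      right
      simp only
      split_ifs <;> first | rfl | omega
    | succ m ih =>
      intro hm
      have h := coord ⟨m + 1, by omega⟩
      rwa [Finset.sum_eq_zero, add_zero] at h
      intro i _
      by_cases hi : (i : ℕ) = m
      · have : i = ⟨m, by omega⟩ := Fin.ext hi
        rw [this, ih (by omega), zero_mul]
      · rw [mul_eq_zero]
        right
        simp only
        split_ifs <;> first | rfl | omega
  have h1 := coord ⟨n, by omega⟩
  have h2 := coord ⟨n + 1, by omega⟩
  rw [Finset.sum_eq_single ⟨n + 1, by omega⟩] at h1
  · rw [Finset.sum_eq_single ⟨n, by omega⟩] at h2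
    · simp at h1 h2
      ext k
      have hk := k.2
      rcases lt_trichotomy (k : ℕ) n with h | h | h
      · exact low k h
      · have : k = ⟨n, by omega⟩ := Fin.ext h
        rw [this, Pi.zero_apply]
        omega
      · have : k = ⟨n + 1, by omega⟩ := Fin.ext (by change (k : ℕ) = n + 1; omega)
        rw [this, Pi.zero_apply]
        omega
    · intro i _ hi
      have hi' : (i : ℕ) ≠ n := fun h => hi (Fin.ext h)
      rw [mul_eq_zero]
      right
      simp only
      split_ifs <;> first | rfl | omega
    · simp
  · intro i _ hi
    have hi' : (i : ℕ) ≠ n + 1 := fun h => hi (Fin.ext h)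
    by_cases h : (i : ℕ) + 1 = n
    · have : i = ⟨i, by omega⟩ := rfl
      rw [this, low i (by omega), zero_mul]
    · rw [mul_eq_zero]
      right
      simp only
      split_ifs <;> first | rfl | omega
  · simp

/-- The Cartan matrix is a Gram matrix `S Sᵀ`, so the form is a sum of squares that vanishes only on
the kernel of `x ↦ x S`. -/
theorem posD (n : ℕ) (x : Fin (n + 3) → ℤ) (hx : x ≠ 0) :
    0 < Matrix.toLinearMap₂' ℤ (cartanOfCoxeter (coxeterMatrixD (n + 3))) x x := by
  rw [Matrix.toLinearMap₂'_apply', ← simpleRootsD_mul_transpose, ← Matrix.mulVec_mulVec,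
    Matrix.dotProduct_mulVec, Matrix.mulVec_transpose]
  refine lt_of_le_of_ne (Finset.sum_nonneg fun i _ => mul_self_nonneg _) fun h => hx ?_
  exact vecMul_simpleRootsD_eq_zero (dotProduct_self_eq_zero.1 h.symm)

/-- The diagram of type `D`, with at least five nodes. -/
def diagramD (n : ℕ) : SimplyLaced (Fin (n + 5)) :=
  .ofCoxeterMatrix (coxeterMatrixD (n + 5)) (posD (n + 2)) ⟨n + 2, by omega⟩
    ![⟨n + 1, by omega⟩, ⟨n + 3, by omega⟩, ⟨n + 4, by omega⟩]
    (by
      intro k l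
      fin_cases k <;> fin_cases l <;> simp)
    (by
      intro k
      rw [coxeterMatrixD_apply]
      fin_cases k <;> simp)
    (by
      intro k l hkl
      rw [coxeterMatrixD_apply]
      fin_cases k <;> fin_cases l <;> simp at hkl ⊢)
    -- The distance from the branch node: the long arm is numbered towards it, and the last two
    -- nodes are both adjacent to it.
    (fun i => if (i : ℕ) ≤ n + 2 then n + 2 - i else 1)
    (by
      intro i hi
      have hi' : (i : ℕ) ≠ n + 2 := fun h => hi (Fin.ext h)
      have hlt := i.2
      by_cases h : (i : ℕ) ≤ n + 2
      · refine ⟨⟨i + 1, by omega⟩, ?_, ?_⟩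
        · simp only
          split_ifs <;> omega
        · rw [coxeterMatrixD_apply, if_neg (by simp [Fin.ext_iff]), if_pos (by simp; omega)]
      · refine ⟨⟨n + 2, by omega⟩, ?_, ?_⟩
        · simp only
          split_ifs <;> omega
        · rw [coxeterMatrixD_apply, if_neg (by simp [Fin.ext_iff]; omega),
            if_pos (by simp; omega)])

theorem coxeterMatrixD_cases (l : ℕ) (i j : Fin l) : coxeterMatrixD l i j = 1 ∨
    coxeterMatrixD l i j = 2 ∨ coxeterMatrixD l i j = 3 := by
  rw [coxeterMatrixD_apply]
  split_ifs <;> simp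

end TypeD

end ReflectionArrangement

end

theorem lemma3p3 {V : Type*} [AddCommGroup V] [Module ℂ V] [FiniteDimensional ℂ V]
    (W : Subgroup (V ≃ₗ[ℂ] V))
    (hW : (∃ l : ℕ, 5 ≤ l ∧
          ReflectionArrangement.HasCoxeterType (ReflectionArrangement.coxeterMatrixD l) W) ∨
        ReflectionArrangement.HasCoxeterType CoxeterMatrix.E₆ W ∨
        ReflectionArrangement.HasCoxeterType CoxeterMatrix.E₇ W ∨
        ReflectionArrangement.HasCoxeterType CoxeterMatrix.E₈ W ∨
        ReflectionArrangement.HasCoxeterType CoxeterMatrix.H₄ W ∨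
        ReflectionArrangement.IsLinearlyConjugate W ReflectionArrangement.groupG32) :
    (¬ ∃ X : Submodule ℂ V,
        ReflectionArrangement.IsModular (ReflectionArrangement.reflectionArrangement W) X ∧
        ReflectionArrangement.rank X = 2) ∧
      ¬ ReflectionArrangement.IsSupersolvable
          (ReflectionArrangement.reflectionArrangement W) := by
  open ReflectionArrangement in
  rcases hW with ⟨l, hl, hW⟩ | hW | hW | hW | hW | hW
  · obtain ⟨n, rfl⟩ := Nat.exists_eq_add_of_le' hl
    exact SimplyLaced.no_modular_rank_two_of_hasCoxeterType (D := diagramD n) rfl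
      (coxeterMatrixD_cases _) hW
  · exact SimplyLaced.no_modular_rank_two_of_hasCoxeterType (D := diagramE6) rfl coxeterMatrixE6_cases hW
  · exact SimplyLaced.no_modular_rank_two_of_hasCoxeterType (D := diagramE7) rfl coxeterMatrixE7_cases hW
  · exact SimplyLaced.no_modular_rank_two_of_hasCoxeterType (D := diagramE8) rfl coxeterMatrixE8_cases hW
  · exact IsLinearlyConjugate.no_modular_rank_two hW realizationH4.no_modular_rank_two
      realizationH4.nontrivial_reflectionArrangement
  · exact hW.no_modular_rank_two realizationG32.no_modular_rank_two
      realizationG32.nontrivial_reflectionArrangement
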